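/- **Setting.** Fix a nominal signature: sorts of atoms $\nu$ (each with infinitely many atoms), sorts of data $\delta$, sorts $\tau ::= \nu \mid \delta \mid \langle\nu\rangle\tau$, function symbols $f:\tau_1\times\dots\times\tau_n\to\delta$, and variables, each having a sort of atoms or a sort of data. Nominal terms are $t ::= f(t_1,\dots,t_n)\mid a\mid a.t\mid \pi\cdot X$, where $\pi$ is a finite list of swappings of atoms of equal sort. A freshness environment $\nabla$ is a finite list of constraints $a\,\#\,X$; the judgements $\nabla\vdash a\,\#\,t$ and $\nabla\vdash t\approx u$ are the usual ones of nominal unification. A substitution $\sigma$ is a finite set of pairs $X\mapsto t$ of equal sort ($X\mapsto X$ is allowed) with domain ${\rm Dom}(\sigma)$. A pair $\langle\nabla,\sigma\rangle$ is a unifier of a problem $P$ (a set of equations $t\approx^? u$ and $a\,\#^?\,t$) if $\nabla\vdash\sigma(t)\approx\sigma(u)$ and $\nabla\vdash a\,\#\,\sigma(t)$, respectively, for all its equations. $\langle\nabla_1,\sigma_1\rangle$ is more general than $\langle\nabla_2,\sigma_2\rangle$ if there is a substitution $\sigma'$ with $\nabla_2\vdash a\,\#\,\sigma'(X)$ for all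 $a\,\#\,X\in\nabla_1$ and $\nabla_2\vdash\sigma'(\sigma_1(X))\approx\sigma_2(X)$ for all $X\in{\rm Dom}(\sigma_1)\cup{\rm Dom}(\sigma_2)$. Consider the simply typed $\lambda$-calculus with one base type for every sort of atoms or data, with $[\nu]=\nu$, $[\delta]=\delta$, $[\langle\nu\rangle\tau]=\nu\to[\tau]$, and with one constant $f:[\tau_1]\to\dots\to[\tau_n]\to[\delta]$ for every function symbol; a variable is given by its name and its type, and equality is modulo $\alpha\beta\eta$. A $\lambda$-substitution $\theta_1$ is more general than $\theta_2$ if for some $\lambda$-substitution $\theta'$ we have $\theta'(\theta_1(X))=\theta_2(X)$ for all $X\in{\rm Dom}(\theta_1)\cup{\rm Dom}(\theta_2)$. Fix a finite list $\langle a_1,\dots,a_n\rangle$ of distinct atoms. Translate terms by $[a]_\nabla=a$, $[f(t_1,\dots,t_k)]_\nabla=f([t_1]_\nabla,\dots,[t_k]_\nabla)$, $[a.t]_\nabla=\lambda a.[t]_\nabla$, and $[\pi\cdot X]_\nabla=X(\pi\cdot b_1,\dots,\pi\cdot b_m)$, where $\langle b_1,\dots,b_m\rangle$ is the sublist of those $a_i$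 with $a_i\,\#\,X\notin\nabla$; and substitutions by $[\sigma]_\nabla=\{X\mapsto\lambda a_1.\cdots\lambda a_n.[\sigma(X)]_\nabla \mid X\in{\rm Dom}(\sigma)\}$. **Lemma.** Let $\langle\nabla_1,\sigma_1\rangle$ and $\langle\nabla_2,\sigma_2\rangle$ be unifiers of a nominal unification problem $P$ with ${\rm Vars}(P)\subseteq{\rm Dom}(\sigma_1)\subseteq{\rm Dom}(\sigma_2)$, and let all atoms that occur in $P,\nabla_1,\nabla_2,\sigma_1,\sigma_2$ be among $a_1,\dots,a_n$. 1. If $\langle\nabla_1,\sigma_1\rangle$ is more general than $\langle\nabla_2,\sigma_2\rangle$, then $[\sigma_1]_{\nabla_1}$ is more general than $[\sigma_2]_{\nabla_2}$. 2. Suppose that for every variable $X$ constrained in $\nabla_1$ (i) $X\notin{\rm Dom}(\sigma_2)\setminus{\rm Dom}(\sigma_1)$, and (ii) $X$ occurs in $\sigma_1$ (that is, $X\in{\rm Vars}(\sigma_1(Y))$ for some $Y\in{\rm Dom}(\sigma_1)$) or there is a term without variables of the sort of $X$. If $[\sigma_1]_{\nabla_1}$ is more general than $[\sigma_2]_{\nabla_2}$,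 then $\langle\nabla_1,\sigma_1\rangle$ is more general than $\langle\nabla_2,\sigma_2\rangle$. In particular, under the supposition of 2, $\langle\nabla_1,\sigma_1\rangle$ is more general than $\langle\nabla_2,\sigma_2\rangle$ if and only if $[\sigma_1]_{\nabla_1}$ is more general than $[\sigma_2]_{\nabla_2}$. -/

import Mathlib

universe u

/-! ### Nominal terms -/

namespace Nominal

/-- Sorts of nominal terms: a base sort is a sort of atoms `.base (.inl ν)` or a sort of data
`.base (.inr δ)`; `.abs ν τ` is the abstraction sort `⟨ν⟩τ`. -/
inductive Srt (A D : Type u) : Type u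
  | base (b : A ⊕ D) : Srt A D
  | abs (ν : A) (τ : Srt A D) : Srt A D

/-- A nominal signature together with its atoms and its variables (unknowns). Every sort of atoms
has infinitely many atoms; variables have a sort of atoms or a sort of data; `Fn [τ₁,…,τₙ] δ` is
the type of the function symbols of arity `τ₁ × ⋯ × τₙ → δ`. -/
structure Signature where
  ASort : Type u
  DSort : Type u
  Atom : ASort → Type u
  Var : ASort ⊕ DSort → Type u
  Fn : List (Srt ASort DSort) → DSort → Type u
  atom_infinite : ∀ ν, Infinite (Atom ν)

variable (S : Signature.{u})

abbrev Sorts : Type u := Srt S.ASort S.DSort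

/-- Atoms of arbitrary sort. -/
abbrev AnyAtom : Type u := Σ ν : S.ASort, S.Atom ν

/-- Variables of arbitrary sort. -/
abbrev AnyVar : Type u := Σ b : S.ASort ⊕ S.DSort, S.Var b

/-- A swapping `(a b)` of two atoms of the same sort. -/
structure Swap where
  srt : S.ASort
  fst : S.Atom srt
  snd : S.Atom srt

/-- A permutation is a finite list of swappings. -/
abbrev Perm : Type u := List (Swap S)

variable {S}

open Classical in
/-- `(a b)·c`, for an atom `c` of any sort. -/
noncomputable def Swap.act (s : Swap S) {ν : S.ASort} (c : S.Atom ν) : S.Atom ν :=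
  if h : s.srt = ν then Equiv.swap (h ▸ s.fst) (h ▸ s.snd) c else c

/-- `(s₁ ⋯ sₙ)·c = s₁·(s₂ ⋯ sₙ·c)`. -/
noncomputable def Perm.act (π : Perm S) {ν : S.ASort} (c : S.Atom ν) : S.Atom ν :=
  List.foldr (fun s x => s.act x) c π

/-- The action on atoms of arbitrary sort. -/
noncomputable def Perm.actAny (π : Perm S) (c : AnyAtom S) : AnyAtom S := ⟨c.1, π.act c.2⟩

/-- `π⁻¹`. -/
def Perm.symm (π : Perm S) : Perm S := List.reverse π

/-- The atoms that are written in `π`. -/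
def Perm.atoms (π : Perm S) : Set (AnyAtom S) :=
  {c | ∃ s : Swap S, s ∈ (show List (Swap S) from π) ∧ (c = ⟨s.srt, s.fst⟩ ∨ c = ⟨s.srt, s.snd⟩)}

variable (S) in
/-- Nominal terms, indexed by their sort: applications `f(t₁,…,tₙ)`, atoms `a`, abstractions `a.t`
and suspensions `π·X`. -/
inductive Term : Sorts S → Type u
  | app {l : List (Sorts S)} {δ : S.DSort} (f : S.Fn l δ)
      (args : ∀ i : Fin l.length, Term (l.get i)) : Term (.base (.inr δ))
  | atom {ν : S.ASort} (a : S.Atom ν) : Term (.base (.inl ν))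
  | abs {ν : S.ASort} {τ : Sorts S} (a : S.Atom ν) (t : Term τ) : Term (.abs ν τ)
  | susp {b : S.ASort ⊕ S.DSort} (π : Perm S) (X : S.Var b) : Term (.base b)

/-- The action `π·t` of a permutation on a term. -/
noncomputable def Term.perm (π : Perm S) : {τ : Sorts S} → Term S τ → Term S τ
  | _, .app f args => .app f (fun i => (args i).perm π)
  | _, .atom a => .atom (π.act a)
  | _, .abs a t => .abs (π.act a) (t.perm π)
  | _, .susp ρ X => .susp (π ++ ρ) X

/-- `Vars(t)`. -/
def Term.vars : {τ : Sorts S} → Term S τ → Set (AnyVar S)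
  | _, .app _ args => {x | ∃ i, x ∈ (args i).vars}
  | _, .atom _ => ∅
  | _, .abs _ t => t.vars
  | _, .susp (b := b) _ X => {⟨b, X⟩}

/-- The atoms occurring (free, bound, binding, or in a suspended permutation) in a term. -/
def Term.atoms : {τ : Sorts S} → Term S τ → Set (AnyAtom S)
  | _, .app _ args => {c | ∃ i, c ∈ (args i).atoms}
  | _, .atom (ν := ν) a => {⟨ν, a⟩}
  | _, .abs (ν := ν) a t => insert ⟨ν, a⟩ t.atoms
  | _, .susp π _ => π.atoms

variable (S) in
/-- A freshness environment: a list of constraints `a # X`. -/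
abbrev FreshEnv : Type u := List (AnyAtom S × AnyVar S)

/-- The judgement `E ⊢ c # t`. -/
inductive Fresh (E : FreshEnv S) (c : AnyAtom S) : {τ : Sorts S} → Term S τ → Prop
  | app {l : List (Sorts S)} {δ : S.DSort} (f : S.Fn l δ)
      (args : ∀ i : Fin l.length, Term S (l.get i)) :
      (∀ i, Fresh E c (args i)) → Fresh E c (.app f args)
  | atom {ν : S.ASort} (a : S.Atom ν) : c ≠ ⟨ν, a⟩ → Fresh E c (.atom a)
  | abs_same {ν : S.ASort} {τ : Sorts S} (a : S.Atom ν) (t : Term S τ) :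
      c = ⟨ν, a⟩ → Fresh E c (.abs a t)
  | abs_ne {ν : S.ASort} {τ : Sorts S} (a : S.Atom ν) (t : Term S τ) :
      c ≠ ⟨ν, a⟩ → Fresh E c t → Fresh E c (.abs a t)
  | susp {b : S.ASort ⊕ S.DSort} (π : Perm S) (X : S.Var b) :
      (π.symm.actAny c, (⟨b, X⟩ : AnyVar S)) ∈ E → Fresh E c (.susp π X)

/-- The judgement `E ⊢ t ≈ u` (α-equivalence). -/
inductive AlphaEq (E : FreshEnv S) : {τ : Sorts S} → Term S τ → Term S τ → Prop
  | app {l : List (Sorts S)} {δ : S.DSort} (f : S.Fn l δ)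
      (args args' : ∀ i : Fin l.length, Term S (l.get i)) :
      (∀ i, AlphaEq E (args i) (args' i)) → AlphaEq E (.app f args) (.app f args')
  | atom {ν : S.ASort} (a : S.Atom ν) : AlphaEq E (.atom a) (.atom a)
  | abs_same {ν : S.ASort} {τ : Sorts S} (a : S.Atom ν) (t t' : Term S τ) :
      AlphaEq E t t' → AlphaEq E (.abs a t) (.abs a t')
  | abs_ne {ν : S.ASort} {τ : Sorts S} (a a' : S.Atom ν) (t t' : Term S τ) :
      a ≠ a' → AlphaEq E t (t'.perm [⟨ν, a, a'⟩]) → Fresh E ⟨ν, a⟩ t' →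
      AlphaEq E (.abs a t) (.abs a' t')
  | susp {b : S.ASort ⊕ S.DSort} (π π' : Perm S) (X : S.Var b) :
      (∀ c : AnyAtom S, π.actAny c ≠ π'.actAny c → (c, (⟨b, X⟩ : AnyVar S)) ∈ E) →
      AlphaEq E (.susp π X) (.susp π' X)

variable (S) in
/-- A substitution `[X₁ ↦ t₁,…,Xₙ ↦ tₙ]` with `dom = {X₁,…,Xₙ}`, extended by the identity to all
variables. A pair `X ↦ X` is allowed, so `dom` is not determined by `map`. -/
structure Subst where
  dom : Finset (AnyVar S)
  map : ∀ b, S.Var b → Term S (.base b)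
  map_of_notMem : ∀ b (X : S.Var b), (⟨b, X⟩ : AnyVar S) ∉ dom → map b X = .susp [] X

/-- `σ(t)`; suspended permutations are applied as soon as their variable is instantiated. -/
noncomputable def Subst.apply (σ : Subst S) : {τ : Sorts S} → Term S τ → Term S τ
  | _, .app f args => .app f (fun i => σ.apply (args i))
  | _, .atom a => .atom a
  | _, .abs a t => .abs a (σ.apply t)
  | _, .susp (b := b) π X => (σ.map b X).perm π

/-- The atoms occurring in `σ`. -/
def Subst.atoms (σ : Subst S) : Set (AnyAtom S) :=
  {c | ∃ X ∈ σ.dom, c ∈ (σ.map X.1 X.2).atoms}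

/-- The variables `X` that occur in `σ`, i.e. `X ∈ Vars(σ(Y))` for some `Y ∈ Dom(σ)`. -/
def Subst.occurring (σ : Subst S) : Set (AnyVar S) :=
  {X | ∃ Y ∈ σ.dom, X ∈ (σ.map Y.1 Y.2).vars}

variable (S) in
/-- Equality equations `t ≈? u` and freshness equations `a #? t`. -/
inductive Eqn : Type u
  | eq {τ : Sorts S} (t u : Term S τ) : Eqn
  | fresh (a : AnyAtom S) {τ : Sorts S} (t : Term S τ) : Eqn

def Eqn.vars : Eqn S → Set (AnyVar S)
  | .eq t u => t.vars ∪ u.vars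
  | .fresh _ t => t.vars

def Eqn.atoms : Eqn S → Set (AnyAtom S)
  | .eq t u => t.atoms ∪ u.atoms
  | .fresh a t => insert a t.atoms

/-- `⟨E, σ⟩` solves an equation. -/
def Eqn.Solves (E : FreshEnv S) (σ : Subst S) : Eqn S → Prop
  | .eq t u => AlphaEq E (σ.apply t) (σ.apply u)
  | .fresh a t => Fresh E a (σ.apply t)

variable (S) in
/-- A nominal unification problem. -/
abbrev Problem : Type u := Set (Eqn S)

/-- `Vars(P)`. -/
def Problem.vars (P : Problem S) : Set (AnyVar S) := {X | ∃ e ∈ P, X ∈ e.vars}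

/-- The atoms occurring in `P`. -/
def Problem.atoms (P : Problem S) : Set (AnyAtom S) := {a | ∃ e ∈ P, a ∈ e.atoms}

/-- `⟨E, σ⟩` is a unifier of `P`. -/
def IsUnifier (P : Problem S) (E : FreshEnv S) (σ : Subst S) : Prop :=
  ∀ e ∈ P, e.Solves E σ

/-- `⟨E₁, σ₁⟩` is more general than `⟨E₂, σ₂⟩`: there is `σ'` with `E₂ ⊢ σ'(E₁)` and
`E₂ ⊢ (σ' ∘ σ₁)|_{Dom(σ₁) ∪ Dom(σ₂)} ≈ σ₂`. -/
def MoreGeneral (E₁ : FreshEnv S) (σ₁ : Subst S) (E₂ : FreshEnv S) (σ₂ : Subst S) : Prop :=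
  ∃ σ' : Subst S,
    (∀ p ∈ E₁, Fresh E₂ p.1 (σ'.map p.2.1 p.2.2)) ∧
    ∀ X : AnyVar S, X ∈ σ₁.dom ∨ X ∈ σ₂.dom →
      AlphaEq E₂ (σ'.apply (σ₁.map X.1 X.2)) (σ₂.map X.1 X.2)

end Nominal

/-! ### The simply typed λ-calculus

Terms are considered up to α-equivalence: bound variables are (typed) de Bruijn indices, free
variables are pairs of a name and a type. -/

namespace Lam

/-- Simple types over the base types `B`. -/
inductive Ty (B : Type u) : Type u
  | base (b : B) : Ty B
  | arrow (σ τ : Ty B) : Ty B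

/-- `σ₁ → ⋯ → σₙ → τ`. -/
def Ty.arrows {B : Type u} : List (Ty B) → Ty B → Ty B
  | [], τ => τ
  | σ :: l, τ => .arrow σ (Ty.arrows l τ)

/-- `Ix Γ τ`: the positions of `τ` in the context `Γ`. -/
inductive Ix {B : Type u} : List (Ty B) → Ty B → Type u
  | zero {Γ : List (Ty B)} {τ : Ty B} : Ix (τ :: Γ) τ
  | succ {Γ : List (Ty B)} {σ τ : Ty B} : Ix Γ τ → Ix (σ :: Γ) τ

/-- λ-terms of type `τ` whose bound variables without binder are typed by `Γ`, with free variables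
`(x, τ)` where `x : N`, and with constants `C τ` of type `τ`. -/
inductive Tm {B : Type u} (N : Type u) (C : Ty B → Type u) : List (Ty B) → Ty B → Type u
  | bvar {Γ : List (Ty B)} {τ : Ty B} (i : Ix Γ τ) : Tm N C Γ τ
  | fvar {Γ : List (Ty B)} (x : N) (τ : Ty B) : Tm N C Γ τ
  | const {Γ : List (Ty B)} {τ : Ty B} (c : C τ) : Tm N C Γ τ
  | lam {Γ : List (Ty B)} {σ τ : Ty B} (t : Tm N C (σ :: Γ) τ) : Tm N C Γ (.arrow σ τ)
  | app {Γ : List (Ty B)} {σ τ : Ty B} (t : Tm N C Γ (.arrow σ τ)) (s : Tm N C Γ σ) : Tm N C Γ τ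

variable {B : Type u} {N : Type u} {C : Ty B → Type u}

/-- Lifting of a renaming of indices under a binder. -/
def liftRen {Γ Δ : List (Ty B)} (ρ : ∀ τ, Ix Γ τ → Ix Δ τ) (σ : Ty B) :
    ∀ τ, Ix (σ :: Γ) τ → Ix (σ :: Δ) τ
  | _, .zero => .zero
  | _, .succ i => .succ (ρ _ i)

/-- Renaming of indices. -/
def Tm.rename {Γ Δ : List (Ty B)} (ρ : ∀ τ, Ix Γ τ → Ix Δ τ) {τ : Ty B} :
    Tm N C Γ τ → Tm N C Δ τ
  | .bvar i => .bvar (ρ _ i)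
  | .fvar x τ => .fvar x τ
  | .const c => .const c
  | .lam t => .lam (t.rename (liftRen ρ _))
  | .app t s => .app (t.rename ρ) (s.rename ρ)

/-- Shifting under one binder. -/
def Tm.shift {Γ : List (Ty B)} {σ τ : Ty B} (t : Tm N C Γ τ) : Tm N C (σ :: Γ) τ :=
  t.rename (fun _ i => .succ i)

/-- Lifting of an instantiation of indices under a binder. -/
def liftInst {Γ Δ : List (Ty B)} (θ : ∀ τ, Ix Γ τ → Tm N C Δ τ) (σ : Ty B) :
    ∀ τ, Ix (σ :: Γ) τ → Tm N C (σ :: Δ) τ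
  | _, .zero => .bvar .zero
  | _, .succ i => (θ _ i).shift

/-- Simultaneous capture-avoiding instantiation of indices. -/
def Tm.inst {Γ Δ : List (Ty B)} (θ : ∀ τ, Ix Γ τ → Tm N C Δ τ) {τ : Ty B} :
    Tm N C Γ τ → Tm N C Δ τ
  | .bvar i => θ _ i
  | .fvar x τ => .fvar x τ
  | .const c => .const c
  | .lam t => .lam (t.inst (liftInst θ _))
  | .app t s => .app (t.inst θ) (s.inst θ)

/-- The instantiation that replaces index `0` by `s` and lowers the others. -/
def instZero {Γ : List (Ty B)} {σ : Ty B} (s : Tm N C Γ σ) : ∀ τ, Ix (σ :: Γ) τ → Tm N C Γ τ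
  | _, .zero => s
  | _, .succ i => .bvar i

/-- Equality of λ-terms modulo α, β and η. -/
inductive Conv : {Γ : List (Ty B)} → {τ : Ty B} → Tm N C Γ τ → Tm N C Γ τ → Prop
  | refl {Γ : List (Ty B)} {τ : Ty B} (t : Tm N C Γ τ) : Conv t t
  | symm {Γ : List (Ty B)} {τ : Ty B} {t s : Tm N C Γ τ} : Conv t s → Conv s t
  | trans {Γ : List (Ty B)} {τ : Ty B} {t s r : Tm N C Γ τ} : Conv t s → Conv s r → Conv t r
  | lam {Γ : List (Ty B)} {σ τ : Ty B} {t t' : Tm N C (σ :: Γ) τ} :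
      Conv t t' → Conv (.lam t) (.lam t')
  | app {Γ : List (Ty B)} {σ τ : Ty B} {t t' : Tm N C Γ (.arrow σ τ)} {s s' : Tm N C Γ σ} :
      Conv t t' → Conv s s' → Conv (.app t s) (.app t' s')
  | beta {Γ : List (Ty B)} {σ τ : Ty B} (t : Tm N C (σ :: Γ) τ) (s : Tm N C Γ σ) :
      Conv (.app (.lam t) s) (t.inst (instZero s))
  | eta {Γ : List (Ty B)} {σ τ : Ty B} (t : Tm N C Γ (.arrow σ τ)) :
      Conv t (.lam (.app t.shift (.bvar .zero)))

variable (N C) in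
/-- A substitution `[X₁ ↦ t₁,…,Xₙ ↦ tₙ]` of free variables, with `dom = {X₁,…,Xₙ}`, extended by the
identity to all free variables. -/
structure Subst where
  dom : Finset (N × Ty B)
  map : N → ∀ τ : Ty B, Tm N C [] τ
  map_of_notMem : ∀ x τ, (x, τ) ∉ dom → map x τ = .fvar x τ

/-- The renaming out of the empty context. -/
def emptyRen {Γ : List (Ty B)} : ∀ τ : Ty B, Ix [] τ → Ix Γ τ := fun _ i => nomatch i

/-- `σ(t)`; this is capture-avoiding, since free and bound variables are kept apart. -/
def Subst.apply (σ : Subst N C) {Γ : List (Ty B)} {τ : Ty B} : Tm N C Γ τ → Tm N C Γ τ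
  | .bvar i => .bvar i
  | .fvar x τ => (σ.map x τ).rename emptyRen
  | .const c => .const c
  | .lam t => .lam (σ.apply t)
  | .app t s => .app (σ.apply t) (σ.apply s)

/-- `σ₁` is more general than `σ₂`: there is `σ'` such that `σ' ∘ σ₁(X) = σ₂(X)` (modulo α, β and η)
for all `X ∈ Dom(σ₁) ∪ Dom(σ₂)`. -/
def MoreGeneral (σ₁ σ₂ : Subst N C) : Prop :=
  ∃ σ' : Subst N C, ∀ (x : N) (τ : Ty B), (x, τ) ∈ σ₁.dom ∨ (x, τ) ∈ σ₂.dom →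
    Conv (σ'.apply (σ₁.map x τ)) (σ₂.map x τ)

end Lam

/-! ### The translation of nominal terms and substitutions -/

namespace Nominal

variable (S : Signature.{u})

/-- There is one base type for every sort of atoms and every sort of data. -/
abbrev LTy : Type u := Lam.Ty (S.ASort ⊕ S.DSort)

/-- The names of the λ-variables: those of the atoms and those of the nominal variables. -/
abbrev LName : Type u := AnyAtom S ⊕ AnyVar S

variable {S}

/-- The translation of sorts to types: `⟨ν⟩τ` becomes `ν → τ`. -/
def trSort : Sorts S → LTy S
  | .base b => .base b
  | .abs ν τ => .arrow (.base (.inl ν)) (trSort τ)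

/-- The type of the λ-variable that corresponds to an atom. -/
def atomTy (c : AnyAtom S) : LTy S := .base (.inl c.1)

variable (S) in
/-- The constants of the λ-calculus: one for every function symbol, a symbol of arity
`τ₁ × ⋯ × τₙ → δ` giving a constant of type `τ₁ → ⋯ → τₙ → δ` (translated). -/
inductive LConst : LTy S → Type u
  | mk {l : List (Sorts S)} {δ : S.DSort} (f : S.Fn l δ) :
      LConst (Lam.Ty.arrows (l.map trSort) (.base (.inr δ)))

variable (S) in
abbrev LTm (Γ : List (LTy S)) (τ : LTy S) : Type u := Lam.Tm (LName S) (LConst S) Γ τ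

variable (S) in
abbrev LSubst : Type u := Lam.Subst (LName S) (LConst S)

/-- `h(s₁,…,sₙ)` for a family of arguments indexed by a list of sorts. -/
def applyArgs {Γ : List (LTy S)} {ρ : LTy S} : (l : List (Sorts S)) →
    LTm S Γ (Lam.Ty.arrows (l.map trSort) ρ) →
    (∀ i : Fin l.length, LTm S Γ (trSort (l.get i))) → LTm S Γ ρ
  | [], h, _ => h
  | _ :: l, h, args =>
      applyArgs l (.app h (args ⟨0, Nat.succ_pos _⟩)) (fun i => args i.succ)

/-- `h(g(b₁),…,g(bₘ))` for a list of atoms `b₁,…,bₘ`. -/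
def applyAtoms {Γ : List (LTy S)} {ρ : LTy S} : (bs : List (AnyAtom S)) →
    LTm S Γ (Lam.Ty.arrows (bs.map atomTy) ρ) → (∀ c : AnyAtom S, LTm S Γ (atomTy c)) → LTm S Γ ρ
  | [], h, _ => h
  | b :: bs, h, g => applyAtoms bs (.app h (g b)) g

open Classical in
/-- The index of the innermost binder with name `c`, where `Γ` is the list of the names of the
binders in whose scope we are, the innermost one first. -/
noncomputable def binderIx (c : AnyAtom S) :
    (Γ : List (AnyAtom S)) → Option (Lam.Ix (Γ.map atomTy) (atomTy c))
  | [] => none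
  | d :: Γ => if h : d = c then some (h ▸ .zero) else (binderIx c Γ).map .succ

/-- The λ-variable with the name of the atom `c`, in the scope of binders with the names `Γ`. -/
noncomputable def trAtom (Γ : List (AnyAtom S)) (c : AnyAtom S) :
    LTm S (Γ.map atomTy) (atomTy c) :=
  match binderIx c Γ with
  | some i => .bvar i
  | none => .fvar (.inl c) (atomTy c)

open Classical in
/-- The sublist `⟨a ∈ L | a # X ∉ E⟩` of `L`. -/
noncomputable def allowed (L : List (AnyAtom S)) (E : FreshEnv S) (X : AnyVar S) :
    List (AnyAtom S) :=
  L.filter (fun a => (a, X) ∉ E)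

/-- The type of the λ-variable that has the name of `X` and the parameters `bs`. -/
def varTy (bs : List (AnyAtom S)) (X : AnyVar S) : LTy S :=
  Lam.Ty.arrows (bs.map atomTy) (.base X.1)

/-- The translation `⟦t⟧_E` of a nominal term with respect to the list of atoms `L`, in the scope of
λ-binders with the names `Γ` (innermost first): `a` becomes the variable `a`, `f(t₁,…,tₙ)` becomes
`f(⟦t₁⟧,…,⟦tₙ⟧)`, `a.t` becomes `λa.⟦t⟧`, and `π·X` becomes `X(π·b₁,…,π·bₘ)` where
`⟨b₁,…,bₘ⟩ = ⟨a ∈ L | a # X ∉ E⟩`. -/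
noncomputable def tr (L : List (AnyAtom S)) (E : FreshEnv S) :
    {τ : Sorts S} → (Γ : List (AnyAtom S)) → Term S τ → LTm S (Γ.map atomTy) (trSort τ)
  | _, Γ, .app (l := l) f args => applyArgs l (.const (.mk f)) (fun i => tr L E Γ (args i))
  | _, Γ, .atom (ν := ν) a => trAtom Γ ⟨ν, a⟩
  | _, Γ, .abs (ν := ν) a t => .lam (tr L E (⟨ν, a⟩ :: Γ) t)
  | _, Γ, .susp (b := b) π X =>
      applyAtoms (allowed L E ⟨b, X⟩) (.fvar (.inr ⟨b, X⟩) (varTy (allowed L E ⟨b, X⟩) ⟨b, X⟩))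
        (fun c => trAtom Γ (π.actAny c))

/-- `λb₁.⋯.λbₘ.⟦t⟧_E`, in the scope of binders with the names `Γ`. -/
noncomputable def trLams (L : List (AnyAtom S)) (E : FreshEnv S) {τ : Sorts S} (t : Term S τ) :
    (bs : List (AnyAtom S)) → (Γ : List (AnyAtom S)) →
    LTm S (Γ.map atomTy) (Lam.Ty.arrows (bs.map atomTy) (trSort τ))
  | [], Γ => tr L E Γ t
  | b :: bs, Γ => .lam (trLams L E t bs (b :: Γ))

open Classical in
/-- The translation `⟦σ⟧_E = [X ↦ λa₁.⋯.λaₙ.⟦σ(X)⟧_E | X ∈ Dom(σ)]` of a nominal substitution with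
respect to the list of atoms `L = ⟨a₁,…,aₙ⟩`; here the replaced λ-variable has the name of `X` and
takes all atoms of `L` as parameters. -/
noncomputable def trSubst (L : List (AnyAtom S)) (E : FreshEnv S) (σ : Subst S) : LSubst S where
  dom := σ.dom.image (fun X => (.inr X, varTy L X))
  map x τ :=
    match x with
    | .inl c => .fvar (.inl c) τ
    | .inr X =>
        if h : X ∈ σ.dom ∧ varTy L X = τ then h.2 ▸ trLams L E (σ.map X.1 X.2) L []
        else .fvar (.inr X) τ
  map_of_notMem := by
    intro x τ hx
    match x with
    | .inl c => rfl
    | .inr X =>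
        have h : ¬ (X ∈ σ.dom ∧ varTy L X = τ) := fun h =>
          hx (Finset.mem_image.mpr ⟨X, h.1, by rw [h.2]⟩)
        exact dif_neg h

end Nominal

/-! ### Renaming and instantiation -/

namespace Lam

variable {B : Type u} {N : Type u} {C : Ty B → Type u}

-- A translated term is β-normal and η-long (`normal_tr`). Every λ-term has such a form, by Tait's
-- method (`exists_normal`), and convertible ones are equal, by evaluation and readback
-- (`Normal.eq_of_conv`). So conversion between translated terms is plain equality. Where all atoms
-- of `L` are bound, equality of translations amounts to `≈` for terms with atoms in `L`
-- (`AlphaEq.tr_eq`, `alphaEq_of_tr_eq`), and an atom of `L` that is not fresh for such a term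
-- leaves a visible index in its translation.
--
-- A suspension `π·X` becomes a higher-order pattern: `X` applied to the distinct variables `π·b`,
-- for the atoms `b` of `L` that `E` leaves unconstrained. If `θ` sends `X` to the abstraction of
-- the translation of `σ(X)` over these `b`, and `σ` respects the constraints, then `θ` applied to a
-- translation converts to the translation of the `σ`-instance (`apply_tr_conv`). Indeed β-reduction
-- at `π·X` renames the atoms of `σ(X)` by `π`, and the atoms missing from the parameter list are
-- fresh for `σ(X)`, so nothing needs to happen to them. This turns a nominal witness into a
-- λ-witness. As the typed λ-variable named `X` may appear both with its unconstrained atoms and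
-- with all of `L` as parameters, `instSubst` instantiates both copies.
--
-- Conversely, a λ-witness `θ` need not look like a translation. But for `Y` in `Dom(σ₁)` the
-- instance of `σ₁(Y)` under `θ` converts to the translation of `σ₂(Y)`. Descending through both
-- terms, one reaches each suspension `π·X` of `σ₁(Y)` opposite some nominal term `u`. Patterns are
-- invertible: `θ(X)` must be the abstraction of the translation of `π⁻¹·u`, and a constrained atom
-- is fresh for `π⁻¹·u` because it is not a parameter (`exists_term_of_conv`). This gives `σ'` on
-- the variables that occur in `σ₁`. Any other variable of `Dom(σ₂) \ Dom(σ₁)` is sent to its value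
-- under `σ₂`; supposition (i) makes it unconstrained. A remaining constrained variable is sent to a
-- variable-free term, supplied by (ii), whose atoms avoid `L`; all other variables are fixed.

theorem liftRen_comp {Γ Δ Θ : List (Ty B)} (ρ : ∀ τ, Ix Γ τ → Ix Δ τ)
    (ρ' : ∀ τ, Ix Δ τ → Ix Θ τ) (σ : Ty B) :
    (fun τ i => liftRen ρ' σ τ (liftRen ρ σ τ i)) = liftRen (fun τ i => ρ' τ (ρ τ i)) σ := by
  funext τ i
  cases i <;> rfl

theorem Tm.rename_rename {Γ : List (Ty B)} {τ : Ty B} (t : Tm N C Γ τ) :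
    ∀ {Δ Θ : List (Ty B)} (ρ : ∀ τ, Ix Γ τ → Ix Δ τ) (ρ' : ∀ τ, Ix Δ τ → Ix Θ τ),
      (t.rename ρ).rename ρ' = t.rename (fun τ i => ρ' τ (ρ τ i)) := by
  induction t with
  | bvar i => intros; rfl
  | fvar x τ => intros; rfl
  | const c => intros; rfl
  | lam t ih => intro _ _ ρ ρ'; simp only [Tm.rename, ih, liftRen_comp]
  | app t s iht ihs => intro _ _ ρ ρ'; simp only [Tm.rename, iht, ihs]

theorem Tm.rename_inst {Γ : List (Ty B)} {τ : Ty B} (t : Tm N C Γ τ) :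
    ∀ {Δ Θ : List (Ty B)} (ρ : ∀ τ, Ix Γ τ → Ix Δ τ) (θ : ∀ τ, Ix Δ τ → Tm N C Θ τ),
      (t.rename ρ).inst θ = t.inst (fun τ i => θ τ (ρ τ i)) := by
  induction t with
  | bvar i => intros; rfl
  | fvar x τ => intros; rfl
  | const c => intros; rfl
  | lam t ih =>
    intro _ _ ρ θ
    simp only [Tm.rename, Tm.inst, ih]
    congr 2
    funext τ i
    cases i <;> rfl
  | app t s iht ihs => intro _ _ ρ θ; simp only [Tm.rename, Tm.inst, iht, ihs]

theorem Tm.inst_rename {Γ : List (Ty B)} {τ : Ty B} (t : Tm N C Γ τ) :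
    ∀ {Δ Θ : List (Ty B)} (θ : ∀ τ, Ix Γ τ → Tm N C Δ τ) (ρ : ∀ τ, Ix Δ τ → Ix Θ τ),
      (t.inst θ).rename ρ = t.inst (fun τ i => (θ τ i).rename ρ) := by
  induction t with
  | bvar i => intros; rfl
  | fvar x τ => intros; rfl
  | const c => intros; rfl
  | lam t ih =>
    intro _ _ θ ρ
    simp only [Tm.rename, Tm.inst, ih]
    congr 2
    funext τ i
    cases i with
    | zero => rfl
    | succ i => simp only [liftInst, Tm.shift, Tm.rename_rename]; rfl
  | app t s iht ihs => intro _ _ θ ρ; simp only [Tm.rename, Tm.inst, iht, ihs]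

theorem Tm.inst_inst {Γ : List (Ty B)} {τ : Ty B} (t : Tm N C Γ τ) :
    ∀ {Δ Θ : List (Ty B)} (θ : ∀ τ, Ix Γ τ → Tm N C Δ τ) (θ' : ∀ τ, Ix Δ τ → Tm N C Θ τ),
      (t.inst θ).inst θ' = t.inst (fun τ i => (θ τ i).inst θ') := by
  induction t with
  | bvar i => intros; rfl
  | fvar x τ => intros; rfl
  | const c => intros; rfl
  | lam t ih =>
    intro _ _ θ θ'
    simp only [Tm.inst, ih]
    congr 2
    funext τ i
    cases i with
    | zero => rfl
    | succ i => simp only [liftInst, Tm.shift, Tm.rename_inst, Tm.inst_rename]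
  | app t s iht ihs => intro _ _ θ θ'; simp only [Tm.inst, iht, ihs]

theorem liftInst_bvar {Γ : List (Ty B)} (σ : Ty B) :
    liftInst (fun τ i => (Tm.bvar i : Tm N C Γ τ)) σ = fun _ i => .bvar i := by
  funext τ i
  cases i <;> rfl

theorem Tm.inst_bvar {Γ : List (Ty B)} {τ : Ty B} (t : Tm N C Γ τ) :
    t.inst (fun _ i => .bvar i) = t := by
  induction t with
  | bvar i => rfl
  | fvar x τ => rfl
  | const c => rfl
  | lam t ih => simp only [Tm.inst, liftInst_bvar, ih]
  | app t s iht ihs => simp only [Tm.inst, iht, ihs]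

theorem Tm.rename_eq_inst {Γ Δ : List (Ty B)} {τ : Ty B} (t : Tm N C Γ τ)
    (ρ : ∀ τ, Ix Γ τ → Ix Δ τ) : t.rename ρ = t.inst (fun τ i => .bvar (ρ τ i)) := by
  conv_lhs => rw [← t.inst_bvar]
  rw [Tm.inst_rename]
  rfl

/-- Extension of an instantiation by a value for the index `0`. -/
def consInst {Γ Δ : List (Ty B)} {σ : Ty B} (θ : ∀ τ, Ix Γ τ → Tm N C Δ τ) (s : Tm N C Δ σ) :
    ∀ τ, Ix (σ :: Γ) τ → Tm N C Δ τ
  | _, .zero => s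
  | _, .succ i => θ _ i

theorem Tm.inst_liftInst_instZero {Γ Δ : List (Ty B)} {σ τ : Ty B} (t : Tm N C (σ :: Γ) τ)
    (θ : ∀ τ, Ix Γ τ → Tm N C Δ τ) (s : Tm N C Δ σ) :
    (t.inst (liftInst θ σ)).inst (instZero s) = t.inst (consInst θ s) := by
  rw [Tm.inst_inst]
  congr 1
  funext τ i
  cases i with
  | zero => rfl
  | succ i =>
    simp only [liftInst, Tm.shift, Tm.rename_inst, consInst]
    exact Tm.inst_bvar _

theorem Tm.shift_inst_liftInst {Γ Δ : List (Ty B)} {σ τ : Ty B} (t : Tm N C Γ τ)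
    (θ : ∀ τ, Ix Γ τ → Tm N C Δ τ) : t.shift.inst (liftInst θ σ) = (t.inst θ).shift := by
  rw [Tm.shift, Tm.rename_inst, Tm.shift, Tm.inst_rename]
  rfl

theorem Conv.of_eq {Γ : List (Ty B)} {τ : Ty B} {t s : Tm N C Γ τ} (h : t = s) : Conv t s :=
  h ▸ .refl t

theorem Conv.rename {Γ : List (Ty B)} {τ : Ty B} {t s : Tm N C Γ τ} (h : Conv t s) :
    ∀ {Δ : List (Ty B)} (ρ : ∀ τ, Ix Γ τ → Ix Δ τ), Conv (t.rename ρ) (s.rename ρ) := by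
  induction h with
  | refl t => intros; exact .refl _
  | symm _ ih => intro _ ρ; exact (ih ρ).symm
  | trans _ _ ih₁ ih₂ => intro _ ρ; exact (ih₁ ρ).trans (ih₂ ρ)
  | lam _ ih => intro _ ρ; exact .lam (ih _)
  | app _ _ ih₁ ih₂ => intro _ ρ; exact .app (ih₁ ρ) (ih₂ ρ)
  | beta t s =>
    intro _ ρ
    refine (Conv.beta (t.rename (liftRen ρ _)) (s.rename ρ)).trans (.of_eq ?_)
    rw [Tm.rename_inst, Tm.inst_rename]
    congr 1
    funext τ i
    cases i <;> rfl
  | eta t =>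
    intro _ ρ
    refine (Conv.eta (t.rename ρ)).trans (.of_eq ?_)
    simp only [Tm.rename, Tm.shift, Tm.rename_rename]
    rfl

theorem Conv.app_shift_lam {Γ : List (Ty B)} {σ τ : Ty B} (t : Tm N C (σ :: Γ) τ) :
    Conv (.app (Tm.lam t).shift (.bvar .zero)) t := by
  refine (Conv.beta _ _).trans (.of_eq ?_)
  rw [Tm.rename_inst]
  refine Eq.trans ?_ t.inst_bvar
  congr 1
  funext τ i
  cases i <;> rfl

/-- Apply both abstractions to a new variable and β-reduce. -/
theorem Conv.of_lam {Γ : List (Ty B)} {σ τ : Ty B} {t s : Tm N C (σ :: Γ) τ}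
    (h : Conv (.lam t) (.lam s)) : Conv t s :=
  (Conv.app_shift_lam t).symm.trans
    ((Conv.app (h.rename _) (.refl _)).trans (Conv.app_shift_lam s))

/-! ### Existence of normal forms -/

/-- β-normal η-long forms (`Normal false`) and neutral terms (`Normal true`). -/
inductive Normal : Bool → {Γ : List (Ty B)} → {τ : Ty B} → Tm N C Γ τ → Prop
  | bvar {Γ : List (Ty B)} {τ : Ty B} (i : Ix Γ τ) : Normal true (.bvar i)
  | fvar {Γ : List (Ty B)} (x : N) (τ : Ty B) : Normal true (.fvar (Γ := Γ) x τ)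
  | const {Γ : List (Ty B)} {τ : Ty B} (c : C τ) : Normal true (.const (Γ := Γ) c)
  | app {Γ : List (Ty B)} {σ τ : Ty B} {t : Tm N C Γ (.arrow σ τ)} {s : Tm N C Γ σ} :
      Normal true t → Normal false s → Normal true (.app t s)
  | neutral {Γ : List (Ty B)} {b : B} {t : Tm N C Γ (.base b)} : Normal true t → Normal false t
  | lam {Γ : List (Ty B)} {σ τ : Ty B} {t : Tm N C (σ :: Γ) τ} :
      Normal false t → Normal false (.lam t)

theorem Normal.rename {p : Bool} {Γ : List (Ty B)} {τ : Ty B} {t : Tm N C Γ τ}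
    (h : Normal p t) : ∀ {Δ : List (Ty B)} (ρ : ∀ τ, Ix Γ τ → Ix Δ τ), Normal p (t.rename ρ) := by
  induction h with
  | bvar i => intros; exact .bvar _
  | fvar x τ => intros; exact .fvar _ _
  | const c => intros; exact .const _
  | app _ _ ih₁ ih₂ => intro _ ρ; exact .app (ih₁ ρ) (ih₂ ρ)
  | neutral _ ih => intro _ ρ; exact .neutral (ih ρ)
  | lam _ ih => intro _ ρ; exact .lam (ih _)

theorem Normal.inst {p : Bool} {Γ : List (Ty B)} {τ : Ty B} {t : Tm N C Γ τ}
    (h : Normal p t) : ∀ {Δ : List (Ty B)} (θ : ∀ τ, Ix Γ τ → Tm N C Δ τ),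
      (∀ τ i, Normal true (θ τ i)) → Normal p (t.inst θ) := by
  induction h with
  | bvar i => intro _ θ hθ; exact hθ _ _
  | fvar x τ => intros; exact .fvar _ _
  | const c => intros; exact .const _
  | app _ _ ih₁ ih₂ => intro _ θ hθ; exact .app (ih₁ θ hθ) (ih₂ θ hθ)
  | neutral _ ih => intro _ θ hθ; exact .neutral (ih θ hθ)
  | lam _ ih =>
    intro _ θ hθ
    refine .lam (ih _ ?_)
    intro τ i
    cases i with
    | zero => exact .bvar _
    | succ i => exact (hθ _ i).rename _

/-- Tait's computability predicate. -/
def Red : (τ : Ty B) → {Γ : List (Ty B)} → Tm N C Γ τ → Prop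
  | .base _, _, t => ∃ n, Normal true n ∧ Conv t n
  | .arrow σ τ, Γ, t => ∀ (Δ : List (Ty B)) (ρ : ∀ τ, Ix Γ τ → Ix Δ τ) (s : Tm N C Δ σ),
      Red σ s → Red τ (.app (t.rename ρ) s)

theorem Red.of_conv : ∀ (τ : Ty B) {Γ : List (Ty B)} {t t' : Tm N C Γ τ},
    Conv t t' → Red τ t' → Red τ t
  | .base _, _, _, _, h, ⟨n, hn, hc⟩ => ⟨n, hn, h.trans hc⟩
  | .arrow _ τ, _, _, _, h, ht => fun Δ ρ s hs =>
      Red.of_conv τ (.app (h.rename ρ) (.refl s)) (ht Δ ρ s hs)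

theorem Red.rename : ∀ (τ : Ty B) {Γ Δ : List (Ty B)} {t : Tm N C Γ τ}
    (ρ : ∀ τ, Ix Γ τ → Ix Δ τ), Red τ t → Red τ (t.rename ρ)
  | .base _, _, _, _, ρ, ⟨n, hn, hc⟩ => ⟨n.rename ρ, hn.rename ρ, hc.rename ρ⟩
  | .arrow _ _, _, _, t, ρ, ht => fun Θ ρ' s hs => by
      rw [Tm.rename_rename]
      exact ht Θ _ s hs

/-- Both halves go by one induction on the type. At an arrow, a computable term is η-expanded and
fed a new variable, which is computable by the second half at `σ`; a neutral term stays neutral when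
applied to an argument normalized by the first half at `σ`. The new variable is available because
`Red` at an arrow quantifies over renamings into larger contexts. -/
theorem red_reify_reflect : ∀ (τ : Ty B),
    (∀ {Γ : List (Ty B)} (t : Tm N C Γ τ), Red τ t → ∃ n, Normal false n ∧ Conv t n) ∧
    (∀ {Γ : List (Ty B)} (t : Tm N C Γ τ), Normal true t → Red τ t)
  | .base b => ⟨fun t ⟨n, hn, hc⟩ => ⟨n, .neutral hn, hc⟩, fun t ht => ⟨t, ht, .refl t⟩⟩
  | .arrow σ τ => by
      have hσ := red_reify_reflect σ
      have hτ := red_reify_reflect τ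
      refine ⟨fun {Γ} t ht => ?_, fun {Γ} t ht Δ ρ s hs => ?_⟩
      · obtain ⟨n, hn, hc⟩ := hτ.1 _ (ht (σ :: Γ) (fun _ i => .succ i) (.bvar .zero)
          (hσ.2 _ (.bvar _)))
        exact ⟨.lam n, .lam hn, (Conv.eta t).trans (.lam hc)⟩
      · obtain ⟨n, hn, hc⟩ := hσ.1 s hs
        exact Red.of_conv τ (.app (.refl _) hc) (hτ.2 _ (.app (ht.rename ρ) hn))

/-- The fundamental lemma of the logical relation. Instantiating indices by computable terms is what
makes the induction pass through abstractions; the identity instantiation then gives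
`exists_normal`. -/
theorem red_inst {Γ : List (Ty B)} {τ : Ty B} (t : Tm N C Γ τ) :
    ∀ {Δ : List (Ty B)} (θ : ∀ τ, Ix Γ τ → Tm N C Δ τ), (∀ τ i, Red τ (θ τ i)) →
      Red τ (t.inst θ) := by
  induction t with
  | bvar i => intro _ θ hθ; exact hθ _ i
  | fvar x τ => intros; exact (red_reify_reflect τ).2 _ (.fvar x τ)
  | const c => intros; exact (red_reify_reflect _).2 _ (.const c)
  | lam t ih =>
    intro Δ θ hθ Θ ρ s hs
    refine Red.of_conv _ (.beta _ s) ?_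
    rw [Tm.rename_inst, Tm.inst_inst]
    refine ih _ ?_
    intro τ i
    cases i with
    | zero => exact hs
    | succ i =>
      have : ((θ τ i).shift.inst fun τ j => instZero s τ (liftRen ρ _ τ j)) =
          (θ τ i).rename ρ := by
        rw [Tm.shift, Tm.rename_inst, Tm.rename_eq_inst]
        rfl
      exact this ▸ Red.rename τ ρ (hθ τ i)
  | app t s iht ihs =>
    intro Δ θ hθ
    have := iht θ hθ Δ (fun _ i => i) _ (ihs θ hθ)
    rwa [Tm.rename_eq_inst, Tm.inst_bvar] at this

theorem exists_normal {Γ : List (Ty B)} {τ : Ty B} (t : Tm N C Γ τ) :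
    ∃ n, Normal false n ∧ Conv t n := by
  refine (red_reify_reflect τ).1 t ?_
  rw [← t.inst_bvar]
  exact red_inst t _ fun τ i => (red_reify_reflect τ).2 _ (.bvar i)

/-! ### Uniqueness of normal forms, by evaluation in the full type structure -/

def Ix.toNat : {Γ : List (Ty B)} → {τ : Ty B} → Ix Γ τ → ℕ
  | _, _, .zero => 0
  | _, _, .succ i => i.toNat + 1

theorem Ix.toNat_injective {Γ : List (Ty B)} {τ : Ty B} (i : Ix Γ τ) :
    ∀ j : Ix Γ τ, i.toNat = j.toNat → i = j := by
  induction i with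
  | zero =>
    intro j h
    cases j with
    | zero => rfl
    | succ j => simp [Ix.toNat] at h
  | succ i ih =>
    intro j h
    cases j with
    | zero => simp [Ix.toNat] at h
    | succ j => rw [ih j (by simpa [Ix.toNat] using h)]

/-- Untyped terms, in which bound variables are levels. -/
inductive Raw (N : Type u) (C : Ty B → Type u) : Type u
  | var (k : ℕ) : Raw N C
  | fvar (x : N) (τ : Ty B) : Raw N C
  | const {τ : Ty B} (c : C τ) : Raw N C
  | lam (t : Raw N C) : Raw N C
  -- The argument type is recorded because the type of an application does not determine it;
  -- `Tm.erase` would otherwise not be visibly injective.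
  | app (σ : Ty B) (t s : Raw N C) : Raw N C

variable (N C) in
/-- The full type structure over families of untyped terms. -/
def Sem : Ty B → Type u
  | .base _ => ℕ → Raw N C
  | .arrow σ τ => Sem σ → Sem τ

mutual
-- The natural number is the first unused level. A variable named by its level keeps that name in
-- larger contexts, so no weakening of semantic values is needed.
def reflect : (τ : Ty B) → (ℕ → Raw N C) → Sem N C τ
  | .base _, r => r
  | .arrow σ τ, r => fun x => reflect τ (fun k => .app σ (r k) (reify σ x k))

def reify : (τ : Ty B) → Sem N C τ → ℕ → Raw N C
  | .base _, x => x
  | .arrow σ τ, f => fun k => .lam (reify τ (f (reflect σ (fun _ => .var k))) (k + 1))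
end

/-- Extension of an environment by a value for the index `0`. -/
def consEnv {F : Ty B → Type u} {Γ : List (Ty B)} {σ : Ty B} (x : F σ)
    (η : ∀ τ, Ix Γ τ → F τ) : ∀ τ, Ix (σ :: Γ) τ → F τ
  | _, .zero => x
  | _, .succ i => η _ i

def Tm.eval {Γ : List (Ty B)} {τ : Ty B} :
    Tm N C Γ τ → (∀ τ, Ix Γ τ → Sem N C τ) → Sem N C τ
  | .bvar i, η => η _ i
  | .fvar x τ, _ => reflect τ (fun _ => .fvar x τ)
  | .const c, _ => reflect _ (fun _ => .const c)
  | .lam t, η => fun x => t.eval (consEnv x η)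
  | .app t s, η => (show Sem N C _ → Sem N C _ from t.eval η) (s.eval η)

theorem Tm.eval_rename {Γ : List (Ty B)} {τ : Ty B} (t : Tm N C Γ τ) :
    ∀ {Δ : List (Ty B)} (ρ : ∀ τ, Ix Γ τ → Ix Δ τ) (η : ∀ τ, Ix Δ τ → Sem N C τ),
      (t.rename ρ).eval η = t.eval (fun τ i => η τ (ρ τ i)) := by
  induction t with
  | bvar i => intros; rfl
  | fvar x τ => intros; rfl
  | const c => intros; rfl
  | lam t ih =>
    intro _ ρ η
    funext x
    simp only [Tm.rename, Tm.eval, ih]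
    congr 1
    funext τ i
    cases i <;> rfl
  | app t s iht ihs => intro _ ρ η; simp only [Tm.rename, Tm.eval, iht, ihs]

theorem Tm.eval_inst {Γ : List (Ty B)} {τ : Ty B} (t : Tm N C Γ τ) :
    ∀ {Δ : List (Ty B)} (θ : ∀ τ, Ix Γ τ → Tm N C Δ τ) (η : ∀ τ, Ix Δ τ → Sem N C τ),
      (t.inst θ).eval η = t.eval (fun τ i => (θ τ i).eval η) := by
  induction t with
  | bvar i => intros; rfl
  | fvar x τ => intros; rfl
  | const c => intros; rfl
  | lam t ih =>
    intro _ θ η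
    funext x
    simp only [Tm.inst, Tm.eval, ih]
    congr 1
    funext τ i
    cases i with
    | zero => rfl
    | succ i => simp only [liftInst, Tm.shift, Tm.eval_rename]; rfl
  | app t s iht ihs => intro _ θ η; simp only [Tm.inst, Tm.eval, iht, ihs]

/-- Arrows are interpreted by all functions: β is evaluation in an extended environment, and η is
extensionality. -/
theorem Conv.eval_eq {Γ : List (Ty B)} {τ : Ty B} {t s : Tm N C Γ τ} (h : Conv t s) :
    ∀ η : ∀ τ, Ix Γ τ → Sem N C τ, t.eval η = s.eval η := by
  induction h with
  | refl t => intro _; rfl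
  | symm _ ih => intro η; exact (ih η).symm
  | trans _ _ ih₁ ih₂ => intro η; exact (ih₁ η).trans (ih₂ η)
  | lam _ ih => intro η; funext x; exact ih _
  | app _ _ ih₁ ih₂ => intro η; simp only [Tm.eval, ih₁, ih₂]
  | beta t s =>
    intro η
    rw [Tm.eval_inst]
    simp only [Tm.eval]
    congr 1
    funext τ i
    cases i <;> rfl
  | eta t =>
    intro η
    funext x
    simp only [Tm.eval, Tm.shift, Tm.eval_rename]
    rfl

/-- The levels of the indices in a context extended by a variable of level `k`. -/
def consLevel {Γ : List (Ty B)} {σ : Ty B} (k : ℕ) (ℓ : ∀ τ, Ix Γ τ → ℕ) :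
    ∀ τ, Ix (σ :: Γ) τ → ℕ
  | _, .zero => k
  | _, .succ i => ℓ _ i

/-- The untyped term that corresponds to a term, where the indices have the levels `ℓ`, and the
bound variables the levels `k, k + 1, …`. -/
def Tm.erase {Γ : List (Ty B)} {τ : Ty B} : Tm N C Γ τ → (∀ τ, Ix Γ τ → ℕ) → ℕ → Raw N C
  | .bvar i, ℓ, _ => .var (ℓ _ i)
  | .fvar x τ, _, _ => .fvar x τ
  | .const c, _, _ => .const c
  | .lam t, ℓ, k => .lam (t.erase (consLevel k ℓ) (k + 1))
  | .app (σ := σ) t s, ℓ, k => .app σ (t.erase ℓ k) (s.erase ℓ k)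

/-- Readback recovers a normal form from its value when every index is interpreted by its reflected
level. Neutral terms need the stronger claim that the value is itself the reflection of the erased
term, so that it can be applied to further arguments. -/
theorem Normal.eval_eq {p : Bool} {Γ : List (Ty B)} {τ : Ty B} {t : Tm N C Γ τ}
    (h : Normal p t) : ∀ ℓ : ∀ τ, Ix Γ τ → ℕ,
      (p = true → t.eval (fun τ i => reflect τ (fun _ => .var (ℓ τ i))) =
        reflect τ (fun k => t.erase ℓ k)) ∧
      (p = false → ∀ k, reify τ (t.eval (fun τ i => reflect τ (fun _ => .var (ℓ τ i)))) k =
        t.erase ℓ k) := by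
  induction h with
  | bvar i => intro ℓ; exact ⟨fun _ => rfl, nofun⟩
  | fvar x τ => intro ℓ; exact ⟨fun _ => rfl, nofun⟩
  | const c => intro ℓ; exact ⟨fun _ => rfl, nofun⟩
  | app _ _ ih₁ ih₂ =>
    intro ℓ
    refine ⟨fun _ => ?_, nofun⟩
    simp only [Tm.eval, (ih₁ ℓ).1 rfl, reflect, Tm.erase]
    congr 1
    funext k
    rw [(ih₂ ℓ).2 rfl]
  | neutral _ ih =>
    intro ℓ
    refine ⟨nofun, fun _ k => ?_⟩
    rw [(ih ℓ).1 rfl]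
    rfl
  | lam _ ih =>
    intro ℓ
    refine ⟨nofun, fun _ k => ?_⟩
    simp only [Tm.eval, reify, Tm.erase]
    rw [← (ih (consLevel k ℓ)).2 rfl (k + 1)]
    congr 3
    funext τ i
    cases i <;> rfl

theorem Tm.erase_injective {Γ : List (Ty B)} {τ : Ty B} (t : Tm N C Γ τ) :
    ∀ (s : Tm N C Γ τ) (ℓ : ∀ τ, Ix Γ τ → ℕ) (k : ℕ),
      (∀ σ σ' (i : Ix Γ σ) (j : Ix Γ σ'), ℓ _ i = ℓ _ j → i.toNat = j.toNat) →
      (∀ σ (i : Ix Γ σ), ℓ _ i < k) → t.erase ℓ k = s.erase ℓ k → t = s := by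
  induction t with
  | bvar i =>
    intro s ℓ k h _ e
    cases s <;> simp only [Tm.erase, Raw.var.injEq, reduceCtorEq] at e
    rw [Ix.toNat_injective _ _ (h _ _ _ _ e)]
  | fvar x τ =>
    intro s ℓ k _ _ e
    cases s <;> simp only [Tm.erase, Raw.fvar.injEq, reduceCtorEq] at e
    rw [e.1]
  | const c =>
    intro s ℓ k _ _ e
    cases s <;> simp only [Tm.erase, Raw.const.injEq, reduceCtorEq] at e
    rw [eq_of_heq e.2]
  | lam t ih =>
    intro s ℓ k h hk e
    cases s <;> simp only [Tm.erase, Raw.lam.injEq, reduceCtorEq] at e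
    rw [ih _ _ _ ?_ ?_ e]
    · intro σ σ' i j hij
      cases i with
      | zero =>
        cases j with
        | zero => rfl
        | succ j => exact absurd hij.symm (hk _ j).ne
      | succ i =>
        cases j with
        | zero => exact absurd hij (hk _ i).ne
        | succ j => exact congrArg (· + 1) (h _ _ _ _ hij)
    · intro σ i
      cases i with
      | zero => exact Nat.lt_succ_self k
      | succ i => exact (hk _ i).trans (Nat.lt_succ_self k)
  | app t s iht ihs =>
    intro r ℓ k h hk e
    cases r <;> simp only [Tm.erase, Raw.app.injEq, reduceCtorEq] at e
    obtain ⟨rfl, e₁, e₂⟩ := e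
    rw [iht _ _ _ h hk e₁, ihs _ _ _ h hk e₂]

theorem Ix.toNat_lt {Γ : List (Ty B)} {τ : Ty B} (i : Ix Γ τ) : i.toNat < Γ.length := by
  induction i with
  | zero => simp [Ix.toNat]
  | succ i ih => simpa [Ix.toNat] using ih

theorem Normal.eq_of_conv {Γ : List (Ty B)} {τ : Ty B} {t s : Tm N C Γ τ}
    (ht : Normal false t) (hs : Normal false s) (h : Conv t s) : t = s := by
  -- Index numbers serve as the levels of the context. They are distinct and lie below `Γ.length`,
  -- where the levels of bound variables start.
  refine Tm.erase_injective t s (fun _ i => i.toNat) Γ.length (fun _ _ _ _ e => e)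
    (fun _ i => i.toNat_lt) ?_
  rw [← (ht.eval_eq _).2 rfl, ← (hs.eval_eq _).2 rfl, h.eval_eq]

/-! ### Occurrences of indices, heads and arguments -/

/-- The index `k` occurs in the term. -/
def Tm.HasIx {Γ : List (Ty B)} {τ : Ty B} : Tm N C Γ τ → ℕ → Prop
  | .bvar i, k => i.toNat = k
  | .fvar _ _, _ => False
  | .const _, _ => False
  | .lam t, k => t.HasIx (k + 1)
  | .app t s, k => t.HasIx k ∨ s.HasIx k

theorem Tm.HasIx.of_rename {Γ : List (Ty B)} {τ : Ty B} {t : Tm N C Γ τ} :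
    ∀ {Δ : List (Ty B)} {ρ : ∀ τ, Ix Γ τ → Ix Δ τ} {k : ℕ}, (t.rename ρ).HasIx k →
      ∃ (σ : Ty B) (i : Ix Γ σ), t.HasIx i.toNat ∧ (ρ σ i).toNat = k := by
  induction t with
  | bvar i => intro _ ρ k h; exact ⟨_, i, rfl, h⟩
  | fvar x τ => intro _ ρ k h; exact h.elim
  | const c => intro _ ρ k h; exact h.elim
  | lam t ih =>
    intro _ ρ k h
    obtain ⟨σ, i, hi, e⟩ := ih h
    cases i with
    | zero => simp [liftRen, Ix.toNat] at e
    | succ i => exact ⟨σ, i, hi, Nat.succ_injective e⟩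
  | app t s iht ihs =>
    intro _ ρ k h
    rcases h with h | h
    · obtain ⟨σ, i, hi, e⟩ := iht h
      exact ⟨σ, i, .inl hi, e⟩
    · obtain ⟨σ, i, hi, e⟩ := ihs h
      exact ⟨σ, i, .inr hi, e⟩

theorem Tm.HasIx.of_inst {Γ : List (Ty B)} {τ : Ty B} {t : Tm N C Γ τ} :
    ∀ {Δ : List (Ty B)} {θ : ∀ τ, Ix Γ τ → Tm N C Δ τ} {k : ℕ}, (t.inst θ).HasIx k →
      ∃ (σ : Ty B) (i : Ix Γ σ), (θ σ i).HasIx k := by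
  induction t with
  | bvar i => intro _ θ k h; exact ⟨_, i, h⟩
  | fvar x τ => intro _ θ k h; exact h.elim
  | const c => intro _ θ k h; exact h.elim
  | lam t ih =>
    intro _ θ k h
    obtain ⟨σ, i, hi⟩ := ih h
    cases i with
    | zero => simp [liftInst, Tm.HasIx, Ix.toNat] at hi
    | succ i =>
      obtain ⟨σ', j, hj, e⟩ := hi.of_rename
      exact ⟨σ, i, Nat.succ_injective e ▸ hj⟩
  | app t s iht ihs =>
    intro _ θ k h
    rcases h with h | h
    · exact iht h
    · exact ihs h

/-- The head of a term, if it is a constant or a free variable. -/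
def Tm.head {Γ : List (Ty B)} {τ : Ty B} : Tm N C Γ τ → Option ((N × Ty B) ⊕ Σ τ, C τ)
  | .bvar _ => none
  | .fvar x τ => some (.inl (x, τ))
  | .const c => some (.inr ⟨_, c⟩)
  | .lam _ => none
  | .app t _ => t.head

/-- The arguments to which the head of a term is applied. -/
def Tm.args {Γ : List (Ty B)} {τ : Ty B} : Tm N C Γ τ → List (Σ τ, Tm N C Γ τ)
  | .bvar _ => []
  | .fvar _ _ => []
  | .const _ => []
  | .lam _ => []
  | .app t s => t.args ++ [⟨_, s⟩]

theorem Tm.rename_emptyRen {τ : Ty B} (n : Tm N C [] τ) {Γ : List (Ty B)}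
    (θ : ∀ τ, Ix [] τ → Tm N C Γ τ) : n.rename emptyRen = n.inst θ := by
  rw [Tm.rename_eq_inst]
  congr 1
  funext τ i
  cases i

end Lam

/-! ### Permutations, freshness and substitutions -/

namespace Nominal

variable {S : Signature.{u}}

theorem Swap.act_act (s : Swap S) {ν : S.ASort} (c : S.Atom ν) : s.act (s.act c) = c := by
  classical
  unfold Swap.act
  split
  · exact Equiv.swap_apply_self _ _ _
  · rfl

theorem Perm.act_cons (s : Swap S) (π : Perm S) {ν : S.ASort} (c : S.Atom ν) :
    Perm.act (s :: π) c = s.act (π.act c) := rfl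

theorem Perm.act_append (π ρ : Perm S) {ν : S.ASort} (c : S.Atom ν) :
    Perm.act (π ++ ρ) c = π.act (ρ.act c) := by
  simp only [Perm.act, List.foldr_append]

theorem Perm.symm_append (π ρ : Perm S) :
    Perm.symm (π ++ ρ) = Perm.symm ρ ++ Perm.symm π := List.reverse_append

theorem Perm.symm_symm (π : Perm S) : π.symm.symm = π := List.reverse_reverse π

theorem Perm.symm_act_act (π : Perm S) {ν : S.ASort} (c : S.Atom ν) :
    π.symm.act (π.act c) = c := by
  induction π generalizing c with
  | nil => rfl
  | cons s π ih =>
    have : Perm.symm (s :: π) = Perm.symm π ++ [s] := List.reverse_cons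
    rw [this, Perm.act_append, Perm.act_cons]
    change Perm.act (Perm.symm π) (s.act (s.act (Perm.act π c))) = c
    rw [Swap.act_act, ih]

theorem Perm.symm_actAny_actAny (π : Perm S) (c : AnyAtom S) :
    π.symm.actAny (π.actAny c) = c := by
  simp only [Perm.actAny, Perm.symm_act_act]

theorem Perm.actAny_symm_actAny (π : Perm S) (c : AnyAtom S) :
    π.actAny (π.symm.actAny c) = c := by
  have := π.symm.symm_actAny_actAny c
  rwa [π.symm_symm] at this

theorem Perm.actAny_injective (π : Perm S) : Function.Injective π.actAny :=
  Function.LeftInverse.injective π.symm_actAny_actAny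

theorem Perm.actAny_append (π ρ : Perm S) (c : AnyAtom S) :
    Perm.actAny (π ++ ρ) c = π.actAny (ρ.actAny c) := by
  simp only [Perm.actAny, Perm.act_append]

theorem Perm.actAny_cons (s : Swap S) (π : Perm S) (c : AnyAtom S) :
    Perm.actAny (s :: π) c = Perm.actAny [s] (π.actAny c) := rfl

theorem actAny_swap_left {ν : S.ASort} (a b : S.Atom ν) :
    Perm.actAny [⟨ν, a, b⟩] ⟨ν, a⟩ = ⟨ν, b⟩ := by
  simp [Perm.actAny, Perm.act, Swap.act]

theorem actAny_swap_right {ν : S.ASort} (a b : S.Atom ν) :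
    Perm.actAny [⟨ν, a, b⟩] ⟨ν, b⟩ = ⟨ν, a⟩ := by
  simp [Perm.actAny, Perm.act, Swap.act]

theorem actAny_swap_of_ne (s : Swap S) (c : AnyAtom S) (h₁ : c ≠ ⟨s.srt, s.fst⟩)
    (h₂ : c ≠ ⟨s.srt, s.snd⟩) : Perm.actAny [s] c = c := by
  classical
  obtain ⟨ν, c⟩ := c
  obtain ⟨ν', a, b⟩ := s
  simp only [Perm.actAny, Perm.act, List.foldr, Swap.act]
  split
  · rename_i h
    obtain rfl : ν' = ν := h
    refine congrArg _ (Equiv.swap_apply_of_ne_of_ne ?_ ?_)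
    · rintro rfl; exact h₁ rfl
    · rintro rfl; exact h₂ rfl
  · rfl

theorem Perm.actAny_eq_of_notMem (π : Perm S) (c : AnyAtom S) (h : c ∉ π.atoms) :
    π.actAny c = c := by
  induction π with
  | nil => rfl
  | cons s π ih =>
    rw [Perm.actAny_cons, ih fun ⟨s', hs', e⟩ => h ⟨s', List.mem_cons_of_mem _ hs', e⟩]
    exact actAny_swap_of_ne s c (fun e => h ⟨s, List.mem_cons_self, .inl e⟩)
      (fun e => h ⟨s, List.mem_cons_self, .inr e⟩)

theorem Perm.actAny_mem (π : Perm S) {L : Set (AnyAtom S)} (h : π.atoms ⊆ L) {c : AnyAtom S}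
    (hc : c ∈ L) : π.actAny c ∈ L := by
  induction π with
  | nil => exact hc
  | cons s π ih =>
    rw [Perm.actAny_cons]
    have ih := ih fun x ⟨s', hs', e⟩ => h ⟨s', List.mem_cons_of_mem _ hs', e⟩
    by_cases h₁ : Perm.actAny π c = ⟨s.srt, s.fst⟩
    · rw [h₁, actAny_swap_left s.fst s.snd]
      exact h ⟨s, List.mem_cons_self, .inr rfl⟩
    · by_cases h₂ : Perm.actAny π c = ⟨s.srt, s.snd⟩
      · rw [h₂, actAny_swap_right s.fst s.snd]
        exact h ⟨s, List.mem_cons_self, .inl rfl⟩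
      · rwa [actAny_swap_of_ne s _ h₁ h₂]

theorem Perm.atoms_symm (π : Perm S) : π.symm.atoms = π.atoms := by
  ext c
  simp only [Perm.atoms, Perm.symm, Set.mem_ofPred_eq]
  exact exists_congr fun s => and_congr_left fun _ => List.mem_reverse

theorem Perm.atoms_append_subset {π ρ : Perm S} {L : Set (AnyAtom S)} (hπ : π.atoms ⊆ L)
    (hρ : ρ.atoms ⊆ L) : Perm.atoms (π ++ ρ) ⊆ L := by
  rintro c ⟨s, hs, e⟩
  rcases List.mem_append.mp hs with hs | hs
  · exact hπ ⟨s, hs, e⟩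
  · exact hρ ⟨s, hs, e⟩

theorem Term.perm_nil {τ : Sorts S} (t : Term S τ) : t.perm [] = t := by
  induction t with
  | app f args ih => simp only [Term.perm, ih]
  | atom a => rfl
  | abs a t ih => simp only [Term.perm, ih]; rfl
  | susp π X => rfl

theorem Term.atoms_perm_subset {τ : Sorts S} {π : Perm S} {L : Set (AnyAtom S)}
    (hπ : π.atoms ⊆ L) (t : Term S τ) (ht : t.atoms ⊆ L) : (t.perm π).atoms ⊆ L := by
  induction t with
  | app f args ih =>
    rintro c ⟨i, hi⟩
    exact ih i (fun c hc => ht ⟨i, hc⟩) hi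
  | atom a =>
    rintro c rfl
    exact π.actAny_mem hπ (ht rfl)
  | abs a t ih =>
    rintro c (rfl | hc)
    · exact π.actAny_mem hπ (ht (.inl rfl))
    · exact ih (fun c hc => ht (.inr hc)) hc
  | susp ρ X => exact Perm.atoms_append_subset hπ ht

theorem Subst.atoms_apply_subset (σ : Subst S) {L : Set (AnyAtom S)} {τ : Sorts S}
    (t : Term S τ) (ht : t.atoms ⊆ L) (hσ : ∀ X ∈ t.vars, (σ.map X.1 X.2).atoms ⊆ L) :
    (σ.apply t).atoms ⊆ L := by
  induction t with
  | app f args ih =>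
    rintro c ⟨i, hi⟩
    exact ih i (fun c hc => ht ⟨i, hc⟩) (fun X hX => hσ X ⟨i, hX⟩) hi
  | atom a => exact ht
  | abs a t ih =>
    rintro c (rfl | hc)
    · exact ht (.inl rfl)
    · exact ih (fun c hc => ht (.inr hc)) hσ hc
  | susp ρ X => exact Term.atoms_perm_subset ht _ (hσ ⟨_, X⟩ rfl)

theorem Term.vars_finite {τ : Sorts S} (t : Term S τ) : t.vars.Finite := by
  induction t with
  | app f args ih =>
    have : (Term.app f args).vars = ⋃ i, (args i).vars := by
      ext x; simp [Term.vars]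
    rw [this]
    exact Set.finite_iUnion ih
  | atom a => exact Set.finite_empty
  | abs a t ih => exact ih
  | susp ρ X => exact Set.finite_singleton _

theorem Subst.occurring_finite (σ : Subst S) : σ.occurring.Finite := by
  have : σ.occurring = ⋃ Y ∈ σ.dom, (σ.map Y.1 Y.2).vars := by
    ext x; simp [Subst.occurring]
  rw [this]
  exact σ.dom.finite_toSet.biUnion fun Y _ => Term.vars_finite _

-- Inversion and equivariance of freshness

section Fresh

variable {E : FreshEnv S} {c : AnyAtom S}

theorem fresh_app_iff {l : List (Sorts S)} {δ : S.DSort} {f : S.Fn l δ}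
    {args : ∀ i : Fin l.length, Term S (l.get i)} :
    Fresh E c (.app f args) ↔ ∀ i, Fresh E c (args i) :=
  ⟨fun h => by cases h; assumption, .app f args⟩

theorem fresh_atom_iff {ν : S.ASort} {a : S.Atom ν} :
    Fresh E c (.atom a) ↔ c ≠ ⟨ν, a⟩ :=
  ⟨fun h => by cases h; assumption, .atom a⟩

theorem fresh_abs_iff {ν : S.ASort} {τ : Sorts S} {a : S.Atom ν} {t : Term S τ} :
    Fresh E c (.abs a t) ↔ c = ⟨ν, a⟩ ∨ Fresh E c t := by
  refine ⟨fun h => ?_, fun h => ?_⟩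
  · cases h
    · left; assumption
    · right; assumption
  · by_cases hc : c = ⟨ν, a⟩
    · exact .abs_same a t hc
    · exact .abs_ne a t hc (h.resolve_left hc)

theorem fresh_susp_iff {b : S.ASort ⊕ S.DSort} {π : Perm S} {X : S.Var b} :
    Fresh E c (.susp π X) ↔ (π.symm.actAny c, (⟨b, X⟩ : AnyVar S)) ∈ E :=
  ⟨fun h => by cases h; assumption, .susp π X⟩

theorem Fresh.perm {τ : Sorts S} {t : Term S τ} (h : Fresh E c t) (π : Perm S) :
    Fresh E (π.actAny c) (t.perm π) := by
  induction t with
  | app f args ih => exact fresh_app_iff.mpr fun i => ih i (fresh_app_iff.mp h i)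
  | atom a =>
    exact fresh_atom_iff.mpr fun e => fresh_atom_iff.mp h (π.actAny_injective e)
  | abs a t ih =>
    refine fresh_abs_iff.mpr ((fresh_abs_iff.mp h).imp ?_ ih)
    rintro rfl
    rfl
  | susp ρ X =>
    refine fresh_susp_iff.mpr ?_
    rw [Perm.symm_append, Perm.actAny_append, Perm.symm_actAny_actAny]
    exact fresh_susp_iff.mp h

theorem Fresh.of_notMem {τ : Sorts S} {t : Term S τ} (h : c ∉ t.atoms) (hv : t.vars = ∅) :
    Fresh E c t := by
  induction t with
  | app f args ih =>
    refine fresh_app_iff.mpr fun i => ih i (fun hc => h ⟨i, hc⟩) ?_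
    exact Set.eq_empty_of_forall_notMem fun x hx => hv.subset (show x ∈ _ from ⟨i, hx⟩)
  | atom a => exact fresh_atom_iff.mpr h
  | abs a t ih => exact fresh_abs_iff.mpr (.inr (ih (fun hc => h (.inr hc)) hv))
  | susp ρ X => exact (hv.subset (show _ ∈ Term.vars (.susp ρ X) from rfl)).elim

end Fresh

/-- A term without variables can be rewritten so as to avoid finitely many atoms. -/
theorem exists_term_atoms_notMem (L : List (AnyAtom S)) {τ : Sorts S} (t : Term S τ)
    (hv : t.vars = ∅) : ∃ t' : Term S τ, t'.vars = ∅ ∧ ∀ a ∈ t'.atoms, a ∉ L := by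
  have key : ∀ ν : S.ASort, ∃ a : S.Atom ν, (⟨ν, a⟩ : AnyAtom S) ∉ L := by
    intro ν
    have := S.atom_infinite ν
    have hf : ((Sigma.mk ν : S.Atom ν → AnyAtom S) ⁻¹' {x | x ∈ L}).Finite :=
      (List.finite_toSet L).preimage sigma_mk_injective.injOn
    obtain ⟨a, ha⟩ := hf.exists_notMem
    exact ⟨a, ha⟩
  induction t with
  | app f args ih =>
    have hv' : ∀ i, (args i).vars = ∅ := fun i =>
      Set.eq_empty_of_forall_notMem fun x hx => hv.subset (show x ∈ _ from ⟨i, hx⟩)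
    choose args' h₁ h₂ using fun i => ih i (hv' i)
    refine ⟨.app f args', Set.eq_empty_of_forall_notMem ?_, ?_⟩
    · rintro x ⟨i, hi⟩
      rw [h₁ i] at hi
      exact hi
    · rintro a ⟨i, hi⟩
      exact h₂ i a hi
  | atom a =>
    obtain ⟨a', ha'⟩ := key _
    refine ⟨.atom a', rfl, ?_⟩
    rintro _ rfl
    exact ha'
  | abs a t ih =>
    obtain ⟨a', ha'⟩ := key _
    obtain ⟨t', h₁, h₂⟩ := ih hv
    refine ⟨.abs a' t', h₁, ?_⟩
    rintro _ (rfl | h)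
    · exact ha'
    · exact h₂ _ h
  | susp ρ X => exact (hv.subset (show _ ∈ Term.vars (.susp ρ X) from rfl)).elim

/-! ### Translation of atoms -/

open Lam (Tm Conv Normal)

theorem trAtom_cons_self (Γ : List (AnyAtom S)) (c : AnyAtom S) :
    trAtom (c :: Γ) c = .bvar .zero := by
  simp [trAtom, binderIx]

theorem trAtom_cons_of_ne (Γ : List (AnyAtom S)) {c d : AnyAtom S} (h : d ≠ c) :
    trAtom (d :: Γ) c = (trAtom Γ c).shift := by
  simp only [trAtom, binderIx, dif_neg h]
  cases binderIx c Γ <;> rfl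

theorem trAtom_of_notMem {Γ : List (AnyAtom S)} {c : AnyAtom S} (h : c ∉ Γ) :
    trAtom Γ c = .fvar (.inl c) (atomTy c) := by
  induction Γ with
  | nil => rfl
  | cons d Γ ih =>
    rw [trAtom_cons_of_ne Γ (fun e => h (List.mem_cons.mpr (.inl e.symm))),
      ih fun hc => h (List.mem_cons_of_mem _ hc)]
    rfl

theorem exists_trAtom_eq_bvar {Γ : List (AnyAtom S)} {c : AnyAtom S} (h : c ∈ Γ) :
    ∃ i, trAtom Γ c = .bvar i := by
  induction Γ with
  | nil => cases h
  | cons d Γ ih =>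
    by_cases e : d = c
    · subst e
      exact ⟨_, trAtom_cons_self Γ d⟩
    · obtain ⟨i, hi⟩ := ih ((List.mem_cons.mp h).resolve_left (Ne.symm e))
      exact ⟨.succ i, by rw [trAtom_cons_of_ne Γ e, hi]; rfl⟩

theorem exists_hasIx_trAtom {Γ : List (AnyAtom S)} {c : AnyAtom S} (h : c ∈ Γ) :
    ∃ k, (trAtom Γ c).HasIx k := by
  obtain ⟨i, hi⟩ := exists_trAtom_eq_bvar h
  exact ⟨_, by rw [hi]; rfl⟩

theorem normal_trAtom (Γ : List (AnyAtom S)) (c : AnyAtom S) : Normal true (trAtom Γ c) := by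
  unfold trAtom
  split
  · exact .bvar _
  · exact .fvar _ _

theorem hasIx_shift_trAtom (Γ : List (AnyAtom S)) (c : AnyAtom S) (σ : LTy S) (k : ℕ) :
    ((trAtom Γ c).shift (σ := σ)).HasIx k ↔ ∃ j, k = j + 1 ∧ (trAtom Γ c).HasIx j := by
  unfold trAtom
  split
  · simp only [Tm.shift, Tm.rename, Tm.HasIx, Lam.Ix.toNat]
    exact ⟨fun h => ⟨_, h.symm, rfl⟩, fun ⟨j, hk, hj⟩ => by rw [hk, hj]⟩
  · simp [Tm.shift, Tm.rename, Tm.HasIx]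

/-- An outer binder stays visible to the name `c` unless the new binder `d` shadows it. -/
theorem hasIx_trAtom_cons (Γ : List (AnyAtom S)) (c d : AnyAtom S) (k : ℕ) :
    (trAtom (d :: Γ) c).HasIx (k + 1) ↔ d ≠ c ∧ (trAtom Γ c).HasIx k := by
  by_cases e : d = c
  · subst e
    simp [trAtom_cons_self, Tm.HasIx, Lam.Ix.toNat]
  · rw [trAtom_cons_of_ne Γ e, hasIx_shift_trAtom]
    simp [e]

theorem eq_of_hasIx_trAtom {Γ : List (AnyAtom S)} {c c' : AnyAtom S} {k : ℕ}
    (h : (trAtom Γ c).HasIx k) (h' : (trAtom Γ c').HasIx k) : c = c' := by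
  induction Γ generalizing k with
  | nil => exact h.elim
  | cons d Γ ih =>
    cases k with
    | zero =>
      have key : ∀ x, (trAtom (d :: Γ) x).HasIx 0 → d = x := by
        intro x hx
        by_contra e
        rw [trAtom_cons_of_ne Γ e, hasIx_shift_trAtom] at hx
        obtain ⟨j, hj, -⟩ := hx
        exact absurd hj (Nat.succ_ne_zero j).symm
      exact (key c h).symm.trans (key c' h')
    | succ k =>
      exact ih ((hasIx_trAtom_cons _ _ _ _).mp h).2 ((hasIx_trAtom_cons _ _ _ _).mp h').2

theorem trAtom_injective (Γ : List (AnyAtom S)) {ν : S.ASort} {a a' : S.Atom ν}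
    (h : trAtom Γ ⟨ν, a⟩ = trAtom Γ ⟨ν, a'⟩) : a = a' := by
  suffices (⟨ν, a⟩ : AnyAtom S) = ⟨ν, a'⟩ by simpa using this
  by_cases hm : (⟨ν, a⟩ : AnyAtom S) ∈ Γ
  · obtain ⟨k, hk⟩ := exists_hasIx_trAtom hm
    exact eq_of_hasIx_trAtom hk (h ▸ hk)
  · by_cases hm' : (⟨ν, a'⟩ : AnyAtom S) ∈ Γ
    · obtain ⟨k, hk⟩ := exists_hasIx_trAtom hm'
      exact eq_of_hasIx_trAtom (h ▸ hk) hk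
    · rw [trAtom_of_notMem hm, trAtom_of_notMem hm'] at h
      injection h with _ h
      exact Sum.inl_injective h

/-- The translation of `π·c`. -/
noncomputable def permAtom (π : Perm S) (Γ : List (AnyAtom S)) (c : AnyAtom S) :
    LTm S (Γ.map atomTy) (atomTy c) :=
  trAtom Γ (π.actAny c)

theorem permAtom_of_eq {π : Perm S} (Γ : List (AnyAtom S)) {c : AnyAtom S}
    (h : π.actAny c = c) : permAtom π Γ c = trAtom Γ c := by
  have : trAtom Γ (π.actAny c) ≍ trAtom Γ c := by rw [h]
  exact eq_of_heq this

theorem permAtom_congr {π ρ : Perm S} (Γ : List (AnyAtom S)) {c : AnyAtom S}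
    (h : π.actAny c = ρ.actAny c) : permAtom π Γ c = permAtom ρ Γ c := by
  have : trAtom Γ (π.actAny c) ≍ trAtom Γ (ρ.actAny c) := by rw [h]
  exact eq_of_heq this

theorem permAtom_actAny {π ρ : Perm S} (Γ : List (AnyAtom S)) {c : AnyAtom S} :
    permAtom π Γ (ρ.actAny c) = permAtom (π ++ ρ) Γ c := by
  have : trAtom Γ (π.actAny (ρ.actAny c)) ≍ trAtom Γ (Perm.actAny (π ++ ρ) c) := by
    rw [Perm.actAny_append]
  exact eq_of_heq this

theorem normal_permAtom (π : Perm S) (Γ : List (AnyAtom S)) (c : AnyAtom S) :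
    Normal true (permAtom π Γ c) := normal_trAtom Γ _

/-- The instantiation that replaces every index by the value of `g` at the name of its binder. -/
def nameInst {Δ : List (LTy S)} (g : ∀ c : AnyAtom S, LTm S Δ (atomTy c)) :
    (Γ : List (AnyAtom S)) → ∀ τ, Lam.Ix (Γ.map atomTy) τ → LTm S Δ τ
  | [] => fun _ i => nomatch i
  | c :: Γ => Lam.consInst (nameInst g Γ) (g c)

section nameInst

variable {Δ : List (LTy S)} (g : ∀ c : AnyAtom S, LTm S Δ (atomTy c))

theorem trAtom_inst_nameInst {Γ : List (AnyAtom S)} {c : AnyAtom S} (h : c ∈ Γ) :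
    (trAtom Γ c).inst (nameInst g Γ) = g c := by
  induction Γ with
  | nil => cases h
  | cons d Γ ih =>
    by_cases e : d = c
    · subst e
      rw [trAtom_cons_self]
      rfl
    · rw [trAtom_cons_of_ne Γ e, Tm.shift, Tm.rename_inst]
      exact ih ((List.mem_cons.mp h).resolve_left (Ne.symm e))

/-- Case analysis on the indices of a context of names. -/
theorem exists_nameInst_eq (Γ : List (AnyAtom S)) (τ : LTy S) (i : Lam.Ix (Γ.map atomTy) τ) :
    ∃ c ∈ Γ, ∃ h : atomTy c = τ, ∀ {Δ : List (LTy S)} (g : ∀ c, LTm S Δ (atomTy c)),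
      nameInst g Γ τ i = h ▸ g c := by
  induction Γ with
  | nil => cases i
  | cons d Γ ih =>
    cases i with
    | zero => exact ⟨d, List.mem_cons_self, rfl, fun _ => rfl⟩
    | succ i =>
      obtain ⟨c, hc, h, e⟩ := ih i
      exact ⟨c, List.mem_cons_of_mem _ hc, h, e⟩

/-- Without repeated names no binder is shadowed, so each index is recovered from the name of its
binder. -/
theorem nameInst_trAtom {Γ : List (AnyAtom S)} (h : Γ.Nodup) :
    nameInst (trAtom Γ) Γ = fun _ i => .bvar i := by
  induction Γ with
  | nil => funext τ i; cases i
  | cons d Γ ih =>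
    obtain ⟨hd, hΓ⟩ := List.nodup_cons.mp h
    funext τ i
    cases i with
    | zero => exact trAtom_cons_self Γ d
    | succ i =>
      obtain ⟨c, hc, rfl, e⟩ := exists_nameInst_eq Γ τ i
      have e₁ := e (trAtom (d :: Γ))
      have e₂ := e (trAtom Γ)
      rw [ih hΓ] at e₂
      change nameInst (trAtom (d :: Γ)) Γ _ i = _
      rw [e₁]
      change trAtom (d :: Γ) c = _
      rw [trAtom_cons_of_ne Γ fun h => hd (by rwa [h])]
      change _ = trAtom Γ c at e₂
      rw [← e₂]
      rfl

theorem nameInst_inst {Θ : List (LTy S)} (θ : ∀ τ, Lam.Ix Δ τ → LTm S Θ τ)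
    (Γ : List (AnyAtom S)) (τ : LTy S) (i : Lam.Ix (Γ.map atomTy) τ) :
    (nameInst g Γ τ i).inst θ = nameInst (fun c => (g c).inst θ) Γ τ i := by
  obtain ⟨c, -, rfl, e⟩ := exists_nameInst_eq Γ τ i
  rw [e, e]

theorem nameInst_congr {g' : ∀ c : AnyAtom S, LTm S Δ (atomTy c)} {Γ : List (AnyAtom S)}
    (h : ∀ c ∈ Γ, g c = g' c) : nameInst g Γ = nameInst g' Γ := by
  funext τ i
  obtain ⟨c, hc, rfl, e⟩ := exists_nameInst_eq Γ τ i
  rw [e, e, h c hc]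

end nameInst

/-! ### Iterated applications and abstractions -/

section applyArgs

variable {Γ : List (LTy S)} {ρ : LTy S}

theorem applyArgs_inst {Δ : List (LTy S)} (θ : ∀ τ, Lam.Ix Γ τ → LTm S Δ τ) :
    ∀ (l : List (Sorts S)) (h : LTm S Γ (Lam.Ty.arrows (l.map trSort) ρ))
      (x : ∀ i : Fin l.length, LTm S Γ (trSort (l.get i))),
      (applyArgs l h x).inst θ = applyArgs l (h.inst θ) (fun i => (x i).inst θ)
  | [], _, _ => rfl
  | _ :: l, _, _ => applyArgs_inst θ l _ _

theorem apply_applyArgs (θ : LSubst S) :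
    ∀ (l : List (Sorts S)) (h : LTm S Γ (Lam.Ty.arrows (l.map trSort) ρ))
      (x : ∀ i : Fin l.length, LTm S Γ (trSort (l.get i))),
      θ.apply (applyArgs l h x) = applyArgs l (θ.apply h) (fun i => θ.apply (x i))
  | [], _, _ => rfl
  | _ :: l, _, _ => apply_applyArgs θ l _ _

theorem applyArgs_conv :
    ∀ (l : List (Sorts S)) {h h' : LTm S Γ (Lam.Ty.arrows (l.map trSort) ρ)}
      {x x' : ∀ i : Fin l.length, LTm S Γ (trSort (l.get i))},
      Conv h h' → (∀ i, Conv (x i) (x' i)) → Conv (applyArgs l h x) (applyArgs l h' x')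
  | [], _, _, _, _, hh, _ => hh
  | _ :: l, _, _, _, _, hh, hx => applyArgs_conv l (.app hh (hx _)) (fun i => hx i.succ)

theorem applyArgs_normal :
    ∀ (l : List (Sorts S)) {h : LTm S Γ (Lam.Ty.arrows (l.map trSort) ρ)}
      {x : ∀ i : Fin l.length, LTm S Γ (trSort (l.get i))},
      Normal true h → (∀ i, Normal false (x i)) → Normal true (applyArgs l h x)
  | [], _, _, hh, _ => hh
  | _ :: l, _, _, hh, hx => applyArgs_normal l (.app hh (hx _)) (fun i => hx i.succ)

theorem hasIx_applyArgs {k : ℕ} :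
    ∀ (l : List (Sorts S)) {h : LTm S Γ (Lam.Ty.arrows (l.map trSort) ρ)}
      {x : ∀ i : Fin l.length, LTm S Γ (trSort (l.get i))},
      (applyArgs l h x).HasIx k ↔ h.HasIx k ∨ ∃ i, (x i).HasIx k
  | [], _, _ => ⟨.inl, fun h => h.resolve_right fun ⟨i, _⟩ => i.elim0⟩
  | _ :: l, h, x => by
      refine (hasIx_applyArgs l).trans ?_
      refine (or_assoc (a := h.HasIx k) (b := (x 0).HasIx k)).trans (or_congr_right ?_)
      exact (Fin.exists_fin_succ (P := fun i => (x i).HasIx k)).symm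

theorem head_applyArgs :
    ∀ (l : List (Sorts S)) (h : LTm S Γ (Lam.Ty.arrows (l.map trSort) ρ))
      (x : ∀ i : Fin l.length, LTm S Γ (trSort (l.get i))), (applyArgs l h x).head = h.head
  | [], _, _ => rfl
  | _ :: l, _, _ => head_applyArgs l _ _

theorem args_applyArgs :
    ∀ (l : List (Sorts S)) (h : LTm S Γ (Lam.Ty.arrows (l.map trSort) ρ))
      (x : ∀ i : Fin l.length, LTm S Γ (trSort (l.get i))),
      (applyArgs l h x).args = h.args ++ List.ofFn fun i => ⟨trSort (l.get i), x i⟩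
  | [], _, _ => (List.append_nil _).symm
  | _ :: l, h, x => by
      refine (args_applyArgs l _ _).trans ((List.append_assoc h.args [⟨_, x 0⟩] _).trans ?_)
      congr 1
      exact (List.ofFn_succ (f := fun i => (⟨trSort ((_ :: l).get i), x i⟩ : Σ τ, LTm S Γ τ))).symm

theorem applyAtoms_inst {Δ : List (LTy S)} (θ : ∀ τ, Lam.Ix Γ τ → LTm S Δ τ) :
    ∀ (bs : List (AnyAtom S)) (h : LTm S Γ (Lam.Ty.arrows (bs.map atomTy) ρ))
      (g : ∀ c, LTm S Γ (atomTy c)),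
      (applyAtoms bs h g).inst θ = applyAtoms bs (h.inst θ) (fun c => (g c).inst θ)
  | [], _, _ => rfl
  | _ :: bs, _, _ => applyAtoms_inst θ bs _ _

theorem apply_applyAtoms (θ : LSubst S) :
    ∀ (bs : List (AnyAtom S)) (h : LTm S Γ (Lam.Ty.arrows (bs.map atomTy) ρ))
      (g : ∀ c, LTm S Γ (atomTy c)),
      θ.apply (applyAtoms bs h g) = applyAtoms bs (θ.apply h) (fun c => θ.apply (g c))
  | [], _, _ => rfl
  | _ :: bs, _, _ => apply_applyAtoms θ bs _ _

theorem applyAtoms_congr :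
    ∀ (bs : List (AnyAtom S)) (h : LTm S Γ (Lam.Ty.arrows (bs.map atomTy) ρ))
      {g g' : ∀ c, LTm S Γ (atomTy c)}, (∀ c ∈ bs, g c = g' c) →
      applyAtoms bs h g = applyAtoms bs h g'
  | [], _, _, _, _ => rfl
  | b :: bs, h, g, g', hg => by
      rw [applyAtoms, applyAtoms, hg b List.mem_cons_self]
      exact applyAtoms_congr bs _ fun c hc => hg c (List.mem_cons_of_mem _ hc)

theorem applyAtoms_conv :
    ∀ (bs : List (AnyAtom S)) {h h' : LTm S Γ (Lam.Ty.arrows (bs.map atomTy) ρ)}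
      (g : ∀ c, LTm S Γ (atomTy c)), Conv h h' → Conv (applyAtoms bs h g) (applyAtoms bs h' g)
  | [], _, _, _, hh => hh
  | _ :: bs, _, _, g, hh => applyAtoms_conv bs g (.app hh (.refl _))

theorem applyAtoms_normal :
    ∀ (bs : List (AnyAtom S)) {h : LTm S Γ (Lam.Ty.arrows (bs.map atomTy) ρ)}
      {g : ∀ c, LTm S Γ (atomTy c)}, Normal true h → (∀ c, Normal true (g c)) →
      Normal true (applyAtoms bs h g)
  | [], _, _, hh, _ => hh
  | b :: bs, _, _, hh, hg => applyAtoms_normal bs (.app hh (.neutral (hg b))) hg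

theorem hasIx_applyAtoms {k : ℕ} :
    ∀ (bs : List (AnyAtom S)) {h : LTm S Γ (Lam.Ty.arrows (bs.map atomTy) ρ)}
      {g : ∀ c, LTm S Γ (atomTy c)},
      (applyAtoms bs h g).HasIx k ↔ h.HasIx k ∨ ∃ c ∈ bs, (g c).HasIx k
  | [], _, _ => ⟨.inl, fun h => h.resolve_right fun ⟨_, hc, _⟩ => nomatch hc⟩
  | b :: bs, h, g => by
      refine (hasIx_applyAtoms bs).trans ?_
      refine (or_assoc (a := h.HasIx k) (b := (g b).HasIx k)).trans (or_congr_right ?_)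
      simp

theorem head_applyAtoms :
    ∀ (bs : List (AnyAtom S)) (h : LTm S Γ (Lam.Ty.arrows (bs.map atomTy) ρ))
      (g : ∀ c, LTm S Γ (atomTy c)), (applyAtoms bs h g).head = h.head
  | [], _, _ => rfl
  | _ :: bs, _, _ => head_applyAtoms bs _ _

theorem args_applyAtoms :
    ∀ (bs : List (AnyAtom S)) (h : LTm S Γ (Lam.Ty.arrows (bs.map atomTy) ρ))
      (g : ∀ c, LTm S Γ (atomTy c)),
      (applyAtoms bs h g).args = h.args ++ bs.map fun c => ⟨atomTy c, g c⟩
  | [], _, _ => (List.append_nil _).symm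
  | b :: bs, h, g => by
      exact (args_applyAtoms bs _ _).trans (List.append_assoc h.args [⟨_, g b⟩] _)

end applyArgs

/-- `λb₁.⋯.λbₘ.t`, in the scope of binders with the names `Γ`. -/
def lams {ρ : LTy S} : (bs Γ : List (AnyAtom S)) → LTm S ((bs.reverseAux Γ).map atomTy) ρ →
    LTm S (Γ.map atomTy) (Lam.Ty.arrows (bs.map atomTy) ρ)
  | [], _, t => t
  | b :: bs, Γ, t => .lam (lams bs (b :: Γ) t)

theorem trLams_eq_lams (L : List (AnyAtom S)) (E : FreshEnv S) {τ : Sorts S} (t : Term S τ) :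
    ∀ bs Γ : List (AnyAtom S), trLams L E t bs Γ = lams bs Γ (tr L E (bs.reverseAux Γ) t)
  | [], _ => rfl
  | b :: bs, Γ => congrArg Tm.lam (trLams_eq_lams L E t bs (b :: Γ))

theorem lams_conv {ρ : LTy S} : ∀ (bs Γ : List (AnyAtom S))
    {t s : LTm S ((bs.reverseAux Γ).map atomTy) ρ}, Conv (lams bs Γ t) (lams bs Γ s) ↔ Conv t s
  | [], _, _, _ => Iff.rfl
  | b :: bs, Γ, _, _ =>
      ⟨fun h => (lams_conv bs (b :: Γ)).mp h.of_lam, fun h => .lam ((lams_conv bs (b :: Γ)).mpr h)⟩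

theorem apply_lams {ρ : LTy S} (θ : LSubst S) : ∀ (bs Γ : List (AnyAtom S))
    (t : LTm S ((bs.reverseAux Γ).map atomTy) ρ), θ.apply (lams bs Γ t) = lams bs Γ (θ.apply t)
  | [], _, _ => rfl
  | b :: bs, Γ, t => congrArg Tm.lam (apply_lams θ bs (b :: Γ) t)

/-- An η-long normal form of arrow type can only be an abstraction. -/
theorem exists_eq_lams {ρ : LTy S} : ∀ (bs Γ : List (AnyAtom S))
    (n : LTm S (Γ.map atomTy) (Lam.Ty.arrows (bs.map atomTy) ρ)), Normal false n →
    ∃ m, Normal false m ∧ n = lams bs Γ m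
  | [], _, n, hn => ⟨n, hn, rfl⟩
  | b :: bs, Γ, n, hn => by
      obtain ⟨n', hn', rfl⟩ : ∃ n', Normal false n' ∧ n = .lam n' := by
        cases hn with
        | lam h => exact ⟨_, h, rfl⟩
      obtain ⟨m, hm, rfl⟩ := exists_eq_lams bs (b :: Γ) n' hn'
      exact ⟨m, hm, rfl⟩

/-- Iterated β-reduction, with the simultaneous instantiation accumulated in `nameInst`. -/
theorem applyAtoms_lams_conv {Δ : List (LTy S)} {ρ : LTy S} (g : ∀ c, LTm S Δ (atomTy c)) :
    ∀ (bs Γ : List (AnyAtom S)) (t : LTm S ((bs.reverseAux Γ).map atomTy) ρ),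
      Conv (applyAtoms bs ((lams bs Γ t).inst (nameInst g Γ)) g)
        (t.inst (nameInst g (bs.reverseAux Γ)))
  | [], _, _ => .refl _
  | b :: bs, Γ, t => by
      refine (applyAtoms_conv bs g ?_).trans (applyAtoms_lams_conv g bs (b :: Γ) t)
      refine (Conv.beta _ _).trans (.of_eq ?_)
      rw [Tm.inst_liftInst_instZero]
      rfl

end Nominal

/-! ### Translation of terms -/

namespace Nominal

variable {S : Signature.{u}}

open Lam (Tm Conv Normal)

theorem mem_allowed {L : List (AnyAtom S)} {E : FreshEnv S} {X : AnyVar S} {c : AnyAtom S} :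
    c ∈ allowed L E X ↔ c ∈ L ∧ (c, X) ∉ E := by
  simp [allowed]

theorem mem_reverseAux_allowed {L : List (AnyAtom S)} {E : FreshEnv S} {X : AnyVar S}
    {c : AnyAtom S} : c ∈ (allowed L E X).reverseAux [] ↔ c ∈ L ∧ (c, X) ∉ E := by
  rw [List.mem_reverseAux]
  simp [mem_allowed]

theorem normal_tr (L : List (AnyAtom S)) (E : FreshEnv S) {τ : Sorts S} (t : Term S τ) :
    ∀ Γ : List (AnyAtom S), Normal false (tr L E Γ t) := by
  induction t with
  | app f args ih =>
    intro Γ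
    exact .neutral (applyArgs_normal _ (.const _) fun i => ih i Γ)
  | atom a => intro Γ; exact .neutral (normal_trAtom Γ _)
  | abs a t ih => intro Γ; exact .lam (ih _)
  | susp π X =>
    intro Γ
    exact .neutral (applyAtoms_normal _ (.fvar _ _) fun c => normal_trAtom Γ _)

/-- Only the free atoms of `t` matter, so `θ` is restricted only on atoms that are not fresh. Under
a binder `a` the new context binds `π·a`, and injectivity of `π` prevents it from shadowing the
image of another name. At `ρ·X` the parameters `c` are unconstrained, so the atoms `ρ·c` are not
fresh and the condition applies. The lemma serves for renaming bound atoms, for β-reducing `X(π·b)`,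
and, with `π⁻¹`, for undoing that reduction. -/
theorem tr_inst (L : List (AnyAtom S)) (E : FreshEnv S) (π : Perm S) {τ : Sorts S}
    (t : Term S τ) : ∀ (Γ Δ : List (AnyAtom S))
      (θ : ∀ τ, Lam.Ix (Γ.map atomTy) τ → LTm S (Δ.map atomTy) τ),
      (∀ c, ¬ Fresh E c t → (trAtom Γ c).inst θ = permAtom π Δ c) →
      (tr L E Γ t).inst θ = tr L E Δ (t.perm π) := by
  induction t with
  | app f args ih =>
    intro Γ Δ θ h
    refine (applyArgs_inst θ _ _ _).trans ?_
    refine congrArg (applyArgs _ _) (funext fun i => ih i Γ Δ θ fun c hc => h c fun hc' => ?_)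
    exact hc (fresh_app_iff.mp hc' i)
  | atom a => intro Γ Δ θ h; exact h _ fun hc => fresh_atom_iff.mp hc rfl
  | abs a t ih =>
    intro Γ Δ θ h
    refine congrArg Tm.lam (ih (⟨_, a⟩ :: Γ) (π.actAny ⟨_, a⟩ :: Δ) _ fun c hc => ?_)
    by_cases e : (⟨_, a⟩ : AnyAtom S) = c
    · subst e
      rw [trAtom_cons_self]
      exact (trAtom_cons_self Δ (π.actAny ⟨_, a⟩)).symm
    · rw [trAtom_cons_of_ne Γ e]
      refine (Tm.shift_inst_liftInst _ θ).trans ?_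
      rw [h c fun hc' => (fresh_abs_iff.mp hc').elim (fun e' => e e'.symm) hc]
      exact (trAtom_cons_of_ne Δ fun e' => e (π.actAny_injective e')).symm
  | susp ρ X =>
    intro Γ Δ θ h
    refine (applyAtoms_inst θ _ _ _).trans (applyAtoms_congr _ _ fun c hc => ?_)
    have := h (ρ.actAny c) fun hc' => by
      rw [fresh_susp_iff, Perm.symm_actAny_actAny] at hc'
      exact (mem_allowed.mp hc).2 hc'
    exact this.trans (permAtom_actAny Δ)

/-- The case of `tr_inst` in which a binder is renamed. -/
theorem tr_swap (L : List (AnyAtom S)) (E : FreshEnv S) (Γ : List (AnyAtom S)) {ν : S.ASort}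
    {a a' : S.Atom ν} {τ : Sorts S} {t : Term S τ} (h : Fresh E ⟨ν, a⟩ t) :
    tr L E (⟨ν, a⟩ :: Γ) (t.perm [⟨ν, a, a'⟩]) = tr L E (⟨ν, a'⟩ :: Γ) t := by
  -- As `a` and `a'` have the same sort, both contexts are the same list of types, and the identity
  -- instantiation relates them.
  refine (tr_inst L E _ t (⟨ν, a'⟩ :: Γ) (⟨ν, a⟩ :: Γ) (fun _ i => .bvar i)
    fun c hc => ?_).symm.trans (Tm.inst_bvar _)
  refine (Tm.inst_bvar _).trans ?_
  have h₁ : c ≠ ⟨ν, a⟩ := fun e => hc (e ▸ h)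
  by_cases h₂ : c = ⟨ν, a'⟩
  · subst h₂
    have e : trAtom (⟨ν, a⟩ :: Γ) (Perm.actAny [⟨ν, a, a'⟩] ⟨ν, a'⟩) ≍
        trAtom (⟨ν, a⟩ :: Γ) (⟨ν, a⟩ : AnyAtom S) := by
      rw [actAny_swap_right]
    rw [trAtom_cons_self]
    exact ((eq_of_heq e).trans (trAtom_cons_self _ _)).symm
  · rw [permAtom_of_eq _ (actAny_swap_of_ne _ c h₁ h₂), trAtom_cons_of_ne Γ h₁.symm,
      trAtom_cons_of_ne Γ (Ne.symm h₂)]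
    rfl

/-- De Bruijn indices absorb the renaming of binders. Two suspensions of `X` may disagree only on
atoms constrained by `E`, and those are not passed as parameters. -/
theorem AlphaEq.tr_eq {L : List (AnyAtom S)} {E : FreshEnv S} {τ : Sorts S} {t u : Term S τ}
    (h : AlphaEq E t u) : ∀ Γ, tr L E Γ t = tr L E Γ u := by
  induction h with
  | app f args args' _ ih =>
    intro Γ
    exact congrArg (applyArgs _ _) (funext fun i => ih i Γ)
  | atom a => intro Γ; rfl
  | abs_same a t t' _ ih => intro Γ; exact congrArg Tm.lam (ih _)
  | abs_ne a a' t t' _ _ hf ih =>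
    intro Γ
    exact congrArg Tm.lam ((ih _).trans (tr_swap L E Γ hf))
  | susp π π' X h =>
    intro Γ
    refine applyAtoms_congr _ _ fun c hc => ?_
    have e : π.actAny c = π'.actAny c := by
      by_contra e
      exact (mem_allowed.mp hc).2 (h c e)
    exact permAtom_congr Γ e

-- Free atoms of a term and indices of its translation

section Occurrence

variable {L : List (AnyAtom S)} {E : FreshEnv S}

/-- At `π·X` an atom that is not fresh is passed on as the argument for the parameter `π⁻¹·c`, which
has to lie in `L`; hence the conditions on `c` and on the atoms of `t`. -/
theorem hasIx_tr_of_not_fresh {c : AnyAtom S} {τ : Sorts S} {t : Term S τ} (hc : c ∈ L)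
    (ht : t.atoms ⊆ {a | a ∈ L}) (h : ¬ Fresh E c t) :
    ∀ {Γ : List (AnyAtom S)} {k : ℕ}, (trAtom Γ c).HasIx k → (tr L E Γ t).HasIx k := by
  induction t with
  | app f args ih =>
    intro Γ k hk
    rw [fresh_app_iff] at h
    push Not at h
    obtain ⟨i, hi⟩ := h
    exact (hasIx_applyArgs _).mpr (.inr ⟨i, ih i (fun x hx => ht ⟨i, hx⟩) hi hk⟩)
  | atom a =>
    intro Γ k hk
    rw [fresh_atom_iff, not_not] at h
    subst h
    exact hk
  | abs a t ih =>
    intro Γ k hk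
    rw [fresh_abs_iff, not_or] at h
    exact ih (fun x hx => ht (.inr hx)) h.2
      ((hasIx_trAtom_cons _ _ _ _).mpr ⟨Ne.symm h.1, hk⟩)
  | susp π X =>
    intro Γ k hk
    rw [fresh_susp_iff] at h
    refine (hasIx_applyAtoms _).mpr (.inr ⟨π.symm.actAny c, mem_allowed.mpr ⟨?_, h⟩, ?_⟩)
    · exact π.symm.actAny_mem (L := {a | a ∈ L}) (by rw [π.atoms_symm]; exact ht) hc
    · have e : trAtom Γ (π.actAny (π.symm.actAny c)) ≍ trAtom Γ c := by
        rw [Perm.actAny_symm_actAny]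
      rwa [eq_of_heq e]

/-- Translations refer to binders by name only, so the index of a shadowed binder never appears.
This is the property that `fresh_of_hasIx` exploits. -/
theorem exists_hasIx_of_hasIx_tr {τ : Sorts S} {t : Term S τ} :
    ∀ {Γ : List (AnyAtom S)} {k : ℕ}, (tr L E Γ t).HasIx k → ∃ c, (trAtom Γ c).HasIx k := by
  induction t with
  | app f args ih =>
    intro Γ k h
    obtain ⟨i, hi⟩ := ((hasIx_applyArgs _).mp h).resolve_left id
    exact ih i hi
  | atom a => intro Γ k h; exact ⟨_, h⟩
  | abs a t ih =>
    intro Γ k h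
    obtain ⟨c, hc⟩ := ih h
    exact ⟨c, ((hasIx_trAtom_cons _ _ _ _).mp hc).2⟩
  | susp π X =>
    intro Γ k h
    obtain ⟨c, -, hc⟩ := ((hasIx_applyAtoms _).mp h).resolve_left id
    exact ⟨_, hc⟩

/-- If a translation under the binders `d :: Γ` contains only indices that the names `a :: Γ` can
reach, then `a` is fresh for the translated term, for `a` is shadowed in `a :: Γ`. -/
theorem fresh_of_hasIx {d : AnyAtom S} {Γ : List (AnyAtom S)} {ν : S.ASort} {a : S.Atom ν}
    {τ : Sorts S} {t : Term S τ} (had : d ≠ ⟨ν, a⟩) (ha : (⟨ν, a⟩ : AnyAtom S) ∈ L)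
    (haΓ : (⟨ν, a⟩ : AnyAtom S) ∈ Γ) (ht : t.atoms ⊆ {a | a ∈ L})
    (h : ∀ k, (tr L E (d :: Γ) t).HasIx k → ∃ c, (trAtom (⟨ν, a⟩ :: Γ) c).HasIx k) :
    Fresh E ⟨ν, a⟩ t := by
  by_contra hf
  obtain ⟨k, hk⟩ := exists_hasIx_trAtom haΓ
  obtain ⟨c, hc⟩ := h (k + 1)
    (hasIx_tr_of_not_fresh ha ht hf ((hasIx_trAtom_cons _ _ _ _).mpr ⟨had, hk⟩))
  obtain ⟨hc₁, hc₂⟩ := (hasIx_trAtom_cons _ _ _ _).mp hc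
  exact hc₁ (eq_of_hasIx_trAtom hk hc₂)

end Occurrence

-- Injectivity of the translation

/-- The function symbol of a constant. -/
def LConst.sym : {τ : LTy S} → LConst S τ → Σ (l : List (Sorts S)) (δ : S.DSort), S.Fn l δ
  | _, .mk f => ⟨_, _, f⟩

theorem head_trAtom_ne (Γ : List (AnyAtom S)) (c : AnyAtom S) :
    (∀ X τ, (trAtom Γ c).head ≠ some (.inl (.inr X, τ))) := by
  intro X τ
  unfold trAtom
  split <;> simp [Tm.head]

theorem head_tr_app (L : List (AnyAtom S)) (E : FreshEnv S) (Γ : List (AnyAtom S))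
    {l : List (Sorts S)} {δ : S.DSort} (f : S.Fn l δ)
    (args : ∀ i : Fin l.length, Term S (l.get i)) :
    (tr L E Γ (.app f args)).head = some (.inr ⟨_, .mk f⟩) :=
  head_applyArgs _ _ _

theorem head_tr_susp (L : List (AnyAtom S)) (E : FreshEnv S) (Γ : List (AnyAtom S))
    {b : S.ASort ⊕ S.DSort} (π : Perm S) (X : S.Var b) :
    (tr L E Γ (.susp π X)).head =
      some (.inl (.inr ⟨b, X⟩, varTy (allowed L E ⟨b, X⟩) ⟨b, X⟩)) :=
  head_applyAtoms _ _ _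

/-- A normal application of a function symbol that is a translated term. -/
theorem exists_of_applyArgs_eq_tr {L : List (AnyAtom S)} {E : FreshEnv S} {Γ : List (AnyAtom S)}
    {l : List (Sorts S)} {δ : S.DSort} {f : S.Fn l δ}
    {w : ∀ i : Fin l.length, LTm S (Γ.map atomTy) (trSort (l.get i))}
    {u : Term S (.base (.inr δ))} (h : applyArgs l (.const (.mk f)) w = tr L E Γ u) :
    ∃ args : ∀ i : Fin l.length, Term S (l.get i),
      u = .app f args ∧ ∀ i, w i = tr L E Γ (args i) := by
  cases u with
  | app g args =>
    have hh := congrArg Tm.head h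
    have ha := congrArg Tm.args h
    replace hh := (head_applyArgs _ _ _).symm.trans (hh.trans (head_tr_app L E Γ g args))
    -- The arity of a symbol is hidden in the type of its constant; `LConst.sym` recovers arity,
    -- result sort and symbol together.
    have hs := congrArg (fun o => o.elim none fun s => s.elim (fun _ => none)
      fun c : Σ τ, LConst S τ => some c.2.sym) hh
    simp only [Tm.head, Option.elim, Sum.elim, LConst.sym, Option.some.injEq] at hs
    injection hs with h₁ h₂
    subst h₁
    injection eq_of_heq h₂ with _ h₃
    subst h₃
    refine ⟨args, rfl, fun i => ?_⟩
    have ha' := (args_applyArgs _ _ _).symm.trans (ha.trans (args_applyArgs _ _ _))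
    have := congrFun (List.ofFn_injective (List.append_cancel_left ha')) i
    injection this with _ h₄
  | susp π X =>
    have hh := congrArg Tm.head h
    replace hh := (head_applyArgs _ _ _).symm.trans (hh.trans (head_tr_susp L E Γ π X))
    simp [Tm.head] at hh

/-- The head identifies `X`; the arguments determine the permutation on the unconstrained atoms of
`L`, and nowhere else. -/
theorem exists_of_applyAtoms_eq_tr {L : List (AnyAtom S)} {E : FreshEnv S}
    {Γ : List (AnyAtom S)} {b : S.ASort ⊕ S.DSort} {π : Perm S} {X : S.Var b}
    {u : Term S (.base b)} (h : tr L E Γ (.susp π X) = tr L E Γ u) :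
    ∃ π' : Perm S, u = .susp π' X ∧
      ∀ c ∈ L, (c, (⟨b, X⟩ : AnyVar S)) ∉ E → π.actAny c = π'.actAny c := by
  have hh := congrArg Tm.head h
  rw [head_tr_susp] at hh
  cases u with
  | app g args =>
    rw [head_tr_app] at hh
    simp at hh
  | atom a => exact absurd hh.symm (head_trAtom_ne _ _ _ _)
  | susp π' Y =>
    rw [head_tr_susp] at hh
    have hX : X = Y := by
      simp only [Option.some.injEq, Sum.inl.injEq, Prod.mk.injEq, Sum.inr.injEq, Sigma.mk.injEq,
        heq_eq_eq, true_and] at hh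
      exact hh.1
    subst hX
    refine ⟨π', rfl, fun c hc hcE => ?_⟩
    have ha := congrArg Tm.args h
    have ha' := (args_applyAtoms _ _ _).symm.trans (ha.trans (args_applyAtoms _ _ _))
    have := List.map_inj_left.mp (List.append_cancel_left ha') c (mem_allowed.mpr ⟨hc, hcE⟩)
    injection this with _ h₄
    exact congrArg (Sigma.mk c.1) (trAtom_injective Γ h₄)

/-- The translation of terms whose atoms are in `L` is injective modulo `≈`. -/
theorem alphaEq_of_tr_eq {L : List (AnyAtom S)} {E : FreshEnv S} {τ : Sorts S} (t : Term S τ) :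
    ∀ (u : Term S τ) (Γ : List (AnyAtom S)), L ⊆ Γ → t.atoms ⊆ {a | a ∈ L} →
      u.atoms ⊆ {a | a ∈ L} → tr L E Γ t = tr L E Γ u → AlphaEq E t u := by
  induction t with
  | app f args ih =>
    intro u Γ hL ht hu h
    obtain ⟨args', rfl, hw⟩ := exists_of_applyArgs_eq_tr h
    exact .app f args args' fun i => ih i _ Γ hL (fun x hx => ht ⟨i, hx⟩)
      (fun x hx => hu ⟨i, hx⟩) (hw i)
  | atom a =>
    intro u Γ hL ht hu h
    cases u with
    | atom a' =>
      obtain rfl := trAtom_injective Γ h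
      exact .atom a
    | susp π X =>
      have hh := congrArg Tm.head h
      rw [head_tr_susp] at hh
      exact absurd hh (head_trAtom_ne _ _ _ _)
  | abs a t ih =>
    intro u Γ hL ht hu h
    cases u with
    | abs a' t' =>
      have h : tr L E (⟨_, a⟩ :: Γ) t = tr L E (⟨_, a'⟩ :: Γ) t' := by
        injection h
      have hta : t.atoms ⊆ {a | a ∈ L} := fun x hx => ht (.inr hx)
      have hua : t'.atoms ⊆ {a | a ∈ L} := fun x hx => hu (.inr hx)
      have ha := ht (.inl rfl)
      have ha' := hu (.inl rfl)
      by_cases e : a = a'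
      · subst e
        exact .abs_same a t t' (ih t' _ (List.subset_cons_of_subset _ hL) hta hua h)
      -- The outer binder of `a` in `Γ` is shadowed on the left side of `h` but not on the right, so
      -- a free `a` in `t'` would show as an index that the left side cannot contain.
      · have hf : Fresh E ⟨_, a⟩ t' :=
          fresh_of_hasIx (d := ⟨_, a'⟩) (fun h => e (by simpa using h.symm)) ha (hL ha) hua
            fun k hk => exists_hasIx_of_hasIx_tr (h ▸ hk)
        refine .abs_ne a a' t t' e (ih _ _ (List.subset_cons_of_subset _ hL) hta
          (Term.atoms_perm_subset ?_ _ hua) (h.trans (tr_swap L E Γ (a' := a') hf).symm)) hf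
        rintro c ⟨s, hs, hc⟩
        obtain rfl := List.mem_singleton.mp hs
        rcases hc with rfl | rfl
        · exact ha
        · exact ha'
  | susp π X =>
    intro u Γ hL ht hu h
    obtain ⟨π', rfl, hw⟩ := exists_of_applyAtoms_eq_tr h
    refine .susp π π' X fun c hc => ?_
    -- An unconstrained atom of `L` is a parameter, on which the two permutations agree; an atom
    -- outside `L` is fixed by both.
    by_contra hcE
    by_cases hcL : c ∈ L
    · exact hc (hw c hcL hcE)
    · exact hc ((π.actAny_eq_of_notMem c fun h => hcL (ht h)).trans
        (π'.actAny_eq_of_notMem c fun h => hcL (hu h)).symm)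

/-! ### Translation of instances -/

section Instances

variable {L : List (AnyAtom S)} {E₁ E₂ : FreshEnv S} (θ : LSubst S)

theorem apply_trAtom {Γ : List (AnyAtom S)} {c : AnyAtom S} (h : c ∈ Γ) :
    θ.apply (trAtom Γ c) = trAtom Γ c := by
  obtain ⟨i, hi⟩ := exists_trAtom_eq_bvar h
  rw [hi]
  rfl

theorem apply_tr_susp {Γ : List (AnyAtom S)} (hΓ : L ⊆ Γ) {b : S.ASort ⊕ S.DSort} {π : Perm S}
    (hπ : π.atoms ⊆ {a | a ∈ L}) (X : S.Var b) :
    θ.apply (tr L E₁ Γ (.susp π X)) = applyAtoms (allowed L E₁ ⟨b, X⟩)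
      ((θ.map (.inr ⟨b, X⟩) (varTy (allowed L E₁ ⟨b, X⟩) ⟨b, X⟩)).rename Lam.emptyRen)
      (permAtom π Γ) := by
  refine (apply_applyAtoms θ _ _ _).trans (applyAtoms_congr _ _ fun c hc => ?_)
  exact apply_trAtom θ (hΓ (π.actAny_mem hπ (mem_allowed.mp hc).1))

/-- Since `Γ` binds the atoms of `L`, the arguments `π·b` are bound variables and `θ` acts on the
head alone. What remains is the β-reduction of `θ(X)` applied to them. -/
theorem apply_tr_susp_conv {Γ : List (AnyAtom S)} (hΓ : L ⊆ Γ) {b : S.ASort ⊕ S.DSort}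
    {π : Perm S} (hπ : π.atoms ⊆ {a | a ∈ L}) (X : S.Var b)
    {m : LTm S (((allowed L E₁ ⟨b, X⟩).reverseAux []).map atomTy) (.base b)}
    (h : Conv (θ.map (.inr ⟨b, X⟩) (varTy (allowed L E₁ ⟨b, X⟩) ⟨b, X⟩))
      (lams (allowed L E₁ ⟨b, X⟩) [] m)) :
    Conv (θ.apply (tr L E₁ Γ (.susp π X))) (m.inst (nameInst (permAtom π Γ) _)) := by
  refine (Conv.of_eq (apply_tr_susp θ hΓ hπ X)).trans ?_
  refine (applyAtoms_conv _ _ ((h.rename _).trans (.of_eq ?_))).trans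
    (applyAtoms_lams_conv _ _ _ m)
  exact Tm.rename_emptyRen _ _

/-- The substitution lemma. A parameter dropped because of a constraint in `E₁` is fresh for `σ(X)`,
so the abstraction over the remaining parameters loses nothing. -/
theorem apply_tr_conv (σ : Subst S) {τ : Sorts S} (t : Term S τ) (ht : t.atoms ⊆ {a | a ∈ L})
    (hθ : ∀ X ∈ t.vars, Conv (θ.map (.inr X) (varTy (allowed L E₁ X) X))
      (trLams L E₂ (σ.map X.1 X.2) (allowed L E₁ X) []))
    (hE : ∀ X ∈ t.vars, ∀ a, (a, X) ∈ E₁ → Fresh E₂ a (σ.map X.1 X.2)) :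
    ∀ Γ : List (AnyAtom S), L ⊆ Γ → Γ ⊆ L →
      Conv (θ.apply (tr L E₁ Γ t)) (tr L E₂ Γ (σ.apply t)) := by
  induction t with
  | app f args ih =>
    intro Γ h₁ h₂
    refine (Conv.of_eq (apply_applyArgs θ _ _ _)).trans (applyArgs_conv _ (.refl _) fun i => ?_)
    exact ih i (fun x hx => ht ⟨i, hx⟩) (fun X hX => hθ X ⟨i, hX⟩) (fun X hX => hE X ⟨i, hX⟩)
      Γ h₁ h₂
  | atom a => intro Γ h₁ h₂; exact .of_eq (apply_trAtom θ (h₁ (ht rfl)))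
  | abs a t ih =>
    intro Γ h₁ h₂
    exact .lam (ih (fun x hx => ht (.inr hx)) hθ hE _ (List.subset_cons_of_subset _ h₁)
      (List.cons_subset.mpr ⟨ht (.inl rfl), h₂⟩))
  | @susp b π X =>
    intro Γ h₁ h₂
    have hX := hθ ⟨b, X⟩ rfl
    rw [trLams_eq_lams] at hX
    refine (apply_tr_susp_conv θ h₁ ht X hX).trans (.of_eq ?_)
    refine tr_inst L E₂ π _ _ Γ _ fun c hc => ?_
    by_cases hcL : c ∈ L
    · exact trAtom_inst_nameInst _ (mem_reverseAux_allowed.mpr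
        ⟨hcL, fun h => hc (hE ⟨b, X⟩ rfl c h)⟩)
    -- `σ` may involve atoms outside `L`. They are fixed by `π` and bound in neither context, so
    -- they remain the same free λ-variable.
    · rw [permAtom_of_eq Γ (π.actAny_eq_of_notMem c fun h => hcL (ht h)),
        trAtom_of_notMem fun h => hcL (h₂ h),
        trAtom_of_notMem fun h => hcL (mem_reverseAux_allowed.mp h).1]
      rfl

theorem exists_map_conv_lams (bs : List (AnyAtom S)) (X : AnyVar S) :
    ∃ m : LTm S ((bs.reverseAux []).map atomTy) (.base X.1), Normal false m ∧
      Conv (θ.map (.inr X) (varTy bs X)) (lams bs [] m) := by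
  obtain ⟨n, hn, hc⟩ := Lam.exists_normal (θ.map (.inr X) (varTy bs X))
  obtain ⟨m, hm, rfl⟩ := exists_eq_lams bs [] n hn
  exact ⟨m, hm, hc⟩

/-- Replacing the parameters of the normal form of `θ(X)` by variables creates no redex. The
resulting normal form reaches only binders that are visible by name, just as a translation does,
although `θ(X)` need not be one. -/
theorem exists_normal_apply_tr {τ : Sorts S} (t : Term S τ) (ht : t.atoms ⊆ {a | a ∈ L}) :
    ∀ Γ : List (AnyAtom S), L ⊆ Γ → ∃ w, Normal false w ∧ Conv (θ.apply (tr L E₁ Γ t)) w ∧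
      ∀ k, w.HasIx k → ∃ c, (trAtom Γ c).HasIx k := by
  induction t with
  | app f args ih =>
    intro Γ hΓ
    choose w h₁ h₂ h₃ using fun i => ih i (fun x hx => ht ⟨i, hx⟩) Γ hΓ
    refine ⟨applyArgs _ (.const (.mk f)) w, .neutral (applyArgs_normal _ (.const _) h₁),
      (Conv.of_eq (apply_applyArgs θ _ _ _)).trans (applyArgs_conv _ (.refl _) h₂),
      fun k hk => ?_⟩
    obtain ⟨i, hi⟩ := ((hasIx_applyArgs _).mp hk).resolve_left id
    exact h₃ i k hi
  | atom a =>
    intro Γ hΓ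
    exact ⟨_, .neutral (normal_trAtom Γ _), .of_eq (apply_trAtom θ (hΓ (ht rfl))),
      fun k hk => ⟨_, hk⟩⟩
  | abs a t ih =>
    intro Γ hΓ
    obtain ⟨w, h₁, h₂, h₃⟩ := ih (fun x hx => ht (.inr hx)) (⟨_, a⟩ :: Γ)
      (List.subset_cons_of_subset _ hΓ)
    refine ⟨.lam w, .lam h₁, .lam h₂, fun k hk => ?_⟩
    obtain ⟨c, hc⟩ := h₃ (k + 1) hk
    exact ⟨c, ((hasIx_trAtom_cons _ _ _ _).mp hc).2⟩
  | @susp b π X =>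
    intro Γ hΓ
    obtain ⟨m, hm, hc⟩ := exists_map_conv_lams θ (allowed L E₁ ⟨b, X⟩) ⟨b, X⟩
    refine ⟨_, hm.inst _ ?_, apply_tr_susp_conv θ hΓ ht X hc, fun k hk => ?_⟩
    · intro τ i
      obtain ⟨c, -, rfl, e⟩ := exists_nameInst_eq _ τ i
      rw [e]
      exact normal_permAtom π Γ c
    · obtain ⟨τ, i, hi⟩ := Tm.HasIx.of_inst hk
      obtain ⟨c, -, rfl, e⟩ := exists_nameInst_eq _ τ i
      rw [e] at hi
      exact ⟨_, hi⟩

/-- Inversion of a pattern: distinct parameters sent to distinct variables `π·b` can be sent back by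
`π⁻¹`. If `a` is no parameter, the index of `π·a` cannot come from the instantiation, so `π·a` is
fresh for `u`. -/
theorem eq_tr_of_inst_eq_tr {Γ Γ' : List (AnyAtom S)} (h₁ : L ⊆ Γ) (h₂ : Γ ⊆ L) (h : Γ' ⊆ L)
    (hΓ' : Γ'.Nodup) {π : Perm S} (hπ : π.atoms ⊆ {a | a ∈ L}) {τ : Sorts S}
    {u : Term S τ} (hu : u.atoms ⊆ {a | a ∈ L}) {m : LTm S (Γ'.map atomTy) (trSort τ)}
    (hm : m.inst (nameInst (permAtom π Γ) Γ') = tr L E₂ Γ u) :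
    m = tr L E₂ Γ' (u.perm π.symm) ∧ ∀ a ∈ L, a ∉ Γ' → Fresh E₂ a (u.perm π.symm) := by
  refine ⟨?_, fun a haL haΓ => ?_⟩
  -- Both sides become instances of `m`; the renamings by `π` and by `π⁻¹` compose to the identity
  -- on `Γ'`.
  · rw [← tr_inst L E₂ π.symm u Γ Γ' (nameInst (permAtom π.symm Γ') Γ), ← hm, Tm.inst_inst]
    · refine m.inst_bvar.symm.trans ?_
      congr 1
      funext τ i
      have hsymm : ∀ c ∈ Γ', (permAtom π Γ c).inst (nameInst (permAtom π.symm Γ') Γ) =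
          trAtom Γ' c := fun c hc =>
        (trAtom_inst_nameInst _ (h₁ (π.actAny_mem hπ (h hc)))).trans
          ((permAtom_actAny Γ').trans
            (permAtom_of_eq Γ' (by rw [Perm.actAny_append, Perm.symm_actAny_actAny])))
      rw [nameInst_inst, nameInst_congr _ hsymm, nameInst_trAtom hΓ']
    · intro c _
      by_cases hcL : c ∈ L
      · exact trAtom_inst_nameInst _ (h₁ hcL)
      · rw [permAtom_of_eq Γ' (π.symm.actAny_eq_of_notMem c fun hc => hcL
            (hπ (by rwa [π.atoms_symm] at hc))), trAtom_of_notMem fun hc => hcL (h₂ hc),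
          trAtom_of_notMem fun hc => hcL (h hc)]
        rfl
  · by_cases hf : Fresh E₂ (π.actAny a) u
    · have := hf.perm π.symm
      rwa [Perm.symm_actAny_actAny] at this
    · have haL' := π.actAny_mem hπ haL
      obtain ⟨k, hk⟩ := exists_hasIx_trAtom (h₁ haL')
      have := hasIx_tr_of_not_fresh haL' hu hf hk
      rw [← hm] at this
      obtain ⟨τ, i, hi⟩ := Tm.HasIx.of_inst this
      obtain ⟨d, hd, rfl, e⟩ := exists_nameInst_eq _ τ i
      rw [e] at hi
      exact (haΓ (π.actAny_injective (eq_of_hasIx_trAtom hi hk) ▸ hd)).elim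

/-- If `θ(⟦π·X⟧)` is convertible to the translation of `u`, then `θ(X)` is that of `π⁻¹·u`. -/
theorem conv_trLams_of_conv_susp (hL : L.Nodup) {Γ : List (AnyAtom S)} (h₁ : L ⊆ Γ) (h₂ : Γ ⊆ L)
    {b : S.ASort ⊕ S.DSort} {π : Perm S} (hπ : π.atoms ⊆ {a | a ∈ L}) (X : S.Var b)
    {u : Term S (.base b)} (hu : u.atoms ⊆ {a | a ∈ L})
    (h : Conv (θ.apply (tr L E₁ Γ (.susp π X))) (tr L E₂ Γ u)) :
    Conv (θ.map (.inr ⟨b, X⟩) (varTy (allowed L E₁ ⟨b, X⟩) ⟨b, X⟩))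
        (trLams L E₂ (u.perm π.symm) (allowed L E₁ ⟨b, X⟩) []) ∧
      ∀ a ∈ L, (a, (⟨b, X⟩ : AnyVar S)) ∈ E₁ → Fresh E₂ a (u.perm π.symm) := by
  obtain ⟨m, hm, hc⟩ := exists_map_conv_lams θ (allowed L E₁ ⟨b, X⟩) ⟨b, X⟩
  -- Instantiating a normal form by variables keeps it normal, so conversion sharpens to equality.
  have hmu : m.inst (nameInst (permAtom π Γ) _) = tr L E₂ Γ u := by
    refine Normal.eq_of_conv (hm.inst _ ?_) (normal_tr _ _ _ _)
      ((apply_tr_susp_conv θ h₁ hπ X hc).symm.trans h)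
    intro τ i
    obtain ⟨c, -, rfl, e⟩ := exists_nameInst_eq _ τ i
    rw [e]
    exact normal_permAtom π Γ c
  obtain ⟨rfl, hf⟩ := eq_tr_of_inst_eq_tr h₁ h₂ (fun c hc => (mem_reverseAux_allowed.mp hc).1)
    (by
      rw [List.reverseAux_eq, List.append_nil, List.nodup_reverse]
      exact hL.filter _) hπ hu hmu
  refine ⟨?_, fun a haL haE => hf a haL fun ha => (mem_reverseAux_allowed.mp ha).2 haE⟩
  rw [trLams_eq_lams]
  exact hc

/-- If `θ(⟦t⟧)` is convertible to the translation of a term, then so is `θ(X)`, for `X` in `t`. -/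
theorem exists_term_of_conv (hL : L.Nodup) {τ : Sorts S} (t : Term S τ)
    (ht : t.atoms ⊆ {a | a ∈ L}) : ∀ (u : Term S τ), u.atoms ⊆ {a | a ∈ L} →
      ∀ Γ : List (AnyAtom S), L ⊆ Γ → Γ ⊆ L →
      Conv (θ.apply (tr L E₁ Γ t)) (tr L E₂ Γ u) → ∀ X ∈ t.vars,
      ∃ s : Term S (.base X.1), s.atoms ⊆ {a | a ∈ L} ∧
        Conv (θ.map (.inr X) (varTy (allowed L E₁ X) X)) (trLams L E₂ s (allowed L E₁ X) []) ∧
        ∀ a ∈ L, (a, X) ∈ E₁ → Fresh E₂ a s := by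
  induction t with
  | app f args ih =>
    rintro u hu Γ h₁ h₂ h X ⟨i, hX⟩
    choose w hw₁ hw₂ _ using fun i =>
      exists_normal_apply_tr (E₁ := E₁) θ (args i) (fun x hx => ht ⟨i, hx⟩) Γ h₁
    have hc : Conv (θ.apply (tr L E₁ Γ (.app f args))) (applyArgs _ (.const (.mk f)) w) :=
      (Conv.of_eq (apply_applyArgs θ _ _ _)).trans (applyArgs_conv _ (.refl _) hw₂)
    -- The normal form of the left side has head `f`; uniqueness forces `u` to be an application of
    -- the same symbol.
    have := Normal.eq_of_conv (.neutral (applyArgs_normal _ (.const (.mk f)) hw₁))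
      (normal_tr L E₂ u Γ) (hc.symm.trans h)
    obtain ⟨args', rfl, hw⟩ := exists_of_applyArgs_eq_tr this
    exact ih i (fun x hx => ht ⟨i, hx⟩) (args' i) (fun x hx => hu ⟨i, hx⟩) Γ h₁ h₂
      (hw i ▸ hw₂ i) X hX
  | atom a => intro u hu Γ h₁ h₂ h X hX; exact hX.elim
  | abs a t ih =>
    intro u hu Γ h₁ h₂ h X hX
    cases u with
    | abs a' u =>
      have hta : t.atoms ⊆ {a | a ∈ L} := fun x hx => ht (.inr hx)
      have hua : u.atoms ⊆ {a | a ∈ L} := fun x hx => hu (.inr hx)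
      have ha := ht (.inl rfl)
      have ha' := hu (.inl rfl)
      have h₁' := List.subset_cons_of_subset ⟨_, a⟩ h₁
      have h₂' := List.cons_subset.mpr ⟨ha, h₂⟩
      have h : Conv (θ.apply (tr L E₁ (⟨_, a⟩ :: Γ) t)) (tr L E₂ (⟨_, a'⟩ :: Γ) u) := h.of_lam
      by_cases e : a = a'
      · subst e
        exact ih hta u hua _ h₁' h₂' h X hX
      -- The shadowing argument is run on the normal form `w`, since the instance under `θ` is not
      -- yet known to be a translation over the names `a :: Γ`.
      · obtain ⟨w, hw₁, hw₂, hw₃⟩ := exists_normal_apply_tr (E₁ := E₁) θ t hta _ h₁'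
        have hwu : w = tr L E₂ (⟨_, a'⟩ :: Γ) u :=
          Normal.eq_of_conv hw₁ (normal_tr _ _ _ _) (hw₂.symm.trans h)
        have hf : Fresh E₂ ⟨_, a⟩ u :=
          fresh_of_hasIx (d := ⟨_, a'⟩) (fun h => e (by simpa using h.symm)) ha (h₁ ha) hua
            fun k hk => hw₃ k (hwu ▸ hk)
        -- The bound atom `a'` of the right side is renamed to `a`, so that both bodies live under
        -- the same names.
        refine ih hta (u.perm [⟨_, a, a'⟩]) (Term.atoms_perm_subset ?_ _ hua) _ h₁' h₂'
          (h.trans (.of_eq (tr_swap L E₂ Γ (a' := a') hf).symm)) X hX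
        rintro c ⟨s, hs, hc⟩
        obtain rfl := List.mem_singleton.mp hs
        rcases hc with rfl | rfl
        · exact ha
        · exact ha'
  | @susp b π X =>
    rintro u hu Γ h₁ h₂ h _ rfl
    have := conv_trLams_of_conv_susp θ hL h₁ h₂ ht X hu h
    exact ⟨u.perm π.symm, Term.atoms_perm_subset (by rw [π.atoms_symm]; exact ht) _ hu, this⟩

end Instances

end Nominal

/-! ### Translation of substitutions -/

namespace Lam

/-- The number of arguments of a function of a given type. -/
def Ty.arity {B : Type u} : Ty B → ℕ
  | .base _ => 0
  | .arrow _ τ => τ.arity + 1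

end Lam

namespace Nominal

variable {S : Signature.{u}}

open Lam (Tm Conv Normal)

theorem arity_varTy (X : AnyVar S) : ∀ bs : List (AnyAtom S), (varTy bs X).arity = bs.length
  | [] => rfl
  | _ :: bs => congrArg (· + 1) (arity_varTy X bs)

/-- The arity counts parameters, and a sublist of full length is the whole list. Hence the two
copies of `X` in `instSubst` can clash only where they have the same value. -/
theorem allowed_eq_of_varTy_eq {L : List (AnyAtom S)} {E : FreshEnv S} {X : AnyVar S}
    (h : varTy L X = varTy (allowed L E X) X) : allowed L E X = L := by
  refine List.filter_sublist.eq_of_length ?_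
  have := congrArg Lam.Ty.arity h
  rw [arity_varTy, arity_varTy] at this
  exact this.symm

theorem trSubst_map_of_mem {L : List (AnyAtom S)} {E : FreshEnv S} {σ : Subst S} {X : AnyVar S}
    (h : X ∈ σ.dom) :
    (trSubst L E σ).map (.inr X) (varTy L X) = trLams L E (σ.map X.1 X.2) L [] :=
  dif_pos (show X ∈ σ.dom ∧ varTy L X = varTy L X from ⟨h, rfl⟩)

theorem trSubst_map_of_notMem {L : List (AnyAtom S)} {E : FreshEnv S} {σ : Subst S}
    {X : AnyVar S} (h : X ∉ σ.dom) (τ : LTy S) :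
    (trSubst L E σ).map (.inr X) τ = .fvar (.inr X) τ :=
  dif_neg fun h' => h h'.1

theorem mem_trSubst_dom {L : List (AnyAtom S)} {E : FreshEnv S} {σ : Subst S}
    {p : LName S × LTy S} :
    p ∈ (trSubst L E σ).dom ↔ ∃ X ∈ σ.dom, (.inr X, varTy L X) = p := by
  classical exact Finset.mem_image

theorem apply_fvar (θ : LSubst S) (x : LName S) (τ : LTy S) :
    θ.apply (.fvar (Γ := []) x τ) = θ.map x τ :=
  (Tm.rename_emptyRen _ fun _ i => .bvar i).trans (Tm.inst_bvar _)

theorem Subst.apply_map_of_notMem (σ' σ : Subst S) {X : AnyVar S} (h : X ∉ σ.dom) :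
    σ'.apply (σ.map X.1 X.2) = σ'.map X.1 X.2 := by
  rw [σ.map_of_notMem X.1 X.2 h]
  exact Term.perm_nil _

theorem Subst.atoms_map_subset {L : List (AnyAtom S)} {σ : Subst S} (h : ∀ a ∈ σ.atoms, a ∈ L)
    (X : AnyVar S) : (σ.map X.1 X.2).atoms ⊆ {a | a ∈ L} := by
  by_cases hX : X ∈ σ.dom
  · exact fun a ha => h a ⟨X, hX, ha⟩
  · rw [σ.map_of_notMem X.1 X.2 hX]
    rintro a ⟨s, hs, -⟩
    cases hs

theorem apply_trLams_conv_iff {L : List (AnyAtom S)} {E₁ E₂ : FreshEnv S} (θ : LSubst S)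
    {τ : Sorts S} (t u : Term S τ) (bs Γ : List (AnyAtom S)) :
    Conv (θ.apply (trLams L E₁ t bs Γ)) (trLams L E₂ u bs Γ) ↔
      Conv (θ.apply (tr L E₁ (bs.reverseAux Γ) t)) (tr L E₂ (bs.reverseAux Γ) u) := by
  rw [trLams_eq_lams, trLams_eq_lams, apply_lams, lams_conv]

theorem conv_trLams {L : List (AnyAtom S)} {E : FreshEnv S} {τ : Sorts S}
    {t u : Term S τ} (ht : t.atoms ⊆ {a | a ∈ L}) (hu : u.atoms ⊆ {a | a ∈ L})
    (h : Conv (trLams L E t L []) (trLams L E u L [])) : AlphaEq E t u := by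
  rw [trLams_eq_lams, trLams_eq_lams, lams_conv] at h
  refine alphaEq_of_tr_eq t u _ ?_ ht hu
    (Normal.eq_of_conv (normal_tr _ _ _ _) (normal_tr _ _ _ _) h)
  intro a ha
  simpa using ha

-- Transfer of witnesses between nominal and λ-substitutions

open Classical in
/-- The λ-substitution that corresponds to `σ`, with `X` in `F` instantiated both as a variable with
the parameters `L` and as a variable with the parameters `allowed L E₁ X`. -/
noncomputable def instSubst (L : List (AnyAtom S)) (E₁ E₂ : FreshEnv S) (σ : Subst S)
    (F : Finset (AnyVar S)) : LSubst S where
  dom := F.image (fun X => (.inr X, varTy L X)) ∪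
    F.image (fun X => (.inr X, varTy (allowed L E₁ X) X))
  map x τ :=
    match x with
    | .inl c => .fvar (.inl c) τ
    | .inr X =>
        if h : X ∈ F ∧ varTy L X = τ then h.2 ▸ trLams L E₂ (σ.map X.1 X.2) L []
        else if h : X ∈ F ∧ varTy (allowed L E₁ X) X = τ then
          h.2 ▸ trLams L E₂ (σ.map X.1 X.2) (allowed L E₁ X) []
        else .fvar (.inr X) τ
  map_of_notMem := by
    intro x τ hx
    match x with
    | .inl c => rfl
    | .inr X =>
        have h₁ : ¬ (X ∈ F ∧ varTy L X = τ) := fun h =>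
          hx (Finset.mem_union_left _ (Finset.mem_image.mpr ⟨X, h.1, by rw [h.2]⟩))
        have h₂ : ¬ (X ∈ F ∧ varTy (allowed L E₁ X) X = τ) := fun h =>
          hx (Finset.mem_union_right _ (Finset.mem_image.mpr ⟨X, h.1, by rw [h.2]⟩))
        exact (dif_neg h₁).trans (dif_neg h₂)

theorem instSubst_map {L : List (AnyAtom S)} {E₁ E₂ : FreshEnv S} {σ : Subst S}
    {F : Finset (AnyVar S)} {X : AnyVar S} (h : X ∈ F) :
    (instSubst L E₁ E₂ σ F).map (.inr X) (varTy L X) = trLams L E₂ (σ.map X.1 X.2) L [] :=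
  dif_pos (show X ∈ F ∧ varTy L X = varTy L X from ⟨h, rfl⟩)

theorem instSubst_map_allowed {L : List (AnyAtom S)} {E₁ E₂ : FreshEnv S} {σ : Subst S}
    {F : Finset (AnyVar S)} {X : AnyVar S} (h : X ∈ F) :
    (instSubst L E₁ E₂ σ F).map (.inr X) (varTy (allowed L E₁ X) X) =
      trLams L E₂ (σ.map X.1 X.2) (allowed L E₁ X) [] := by
  by_cases e : varTy L X = varTy (allowed L E₁ X) X
  · rw [allowed_eq_of_varTy_eq e]
    exact instSubst_map h
  · exact (dif_neg fun h' => e h'.2).trans (dif_pos (show X ∈ F ∧ _ = _ from ⟨h, rfl⟩))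

theorem lam_moreGeneral_of_moreGeneral {L : List (AnyAtom S)} {E₁ E₂ : FreshEnv S}
    {σ₁ σ₂ : Subst S} (hσ₁L : ∀ a ∈ σ₁.atoms, a ∈ L) (hdom : σ₁.dom ⊆ σ₂.dom)
    (h : MoreGeneral E₁ σ₁ E₂ σ₂) :
    Lam.MoreGeneral (trSubst L E₁ σ₁) (trSubst L E₂ σ₂) := by
  classical
  obtain ⟨σ, hσE, hσ⟩ := h
  -- A λ-substitution has finite domain; these are the only variables on which the witness is
  -- evaluated.
  let F := σ₂.dom ∪ σ₁.occurring_finite.toFinset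
  refine ⟨instSubst L E₁ E₂ σ F, fun x τ hx => ?_⟩
  obtain ⟨X, hX, e⟩ : ∃ X ∈ σ₂.dom, (.inr X, varTy L X) = (x, τ) := by
    rcases hx with hx | hx <;> obtain ⟨X, hX, e⟩ := mem_trSubst_dom.mp hx
    · exact ⟨X, hdom hX, e⟩
    · exact ⟨X, hX, e⟩
  obtain ⟨rfl, rfl⟩ := Prod.mk.inj e
  have hα := hσ X (.inr hX)
  -- The target is replaced by the equal translation of `σ(σ₁(X))`.
  rw [trSubst_map_of_mem hX, trLams_eq_lams, ← hα.tr_eq, ← trLams_eq_lams]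
  by_cases hX₁ : X ∈ σ₁.dom
  · rw [trSubst_map_of_mem hX₁]
    refine (apply_trLams_conv_iff _ _ _ _ _).mpr ?_
    have hocc : ∀ Y ∈ (σ₁.map X.1 X.2).vars, Y ∈ F := fun Y hY =>
      Finset.mem_union_right _ (σ₁.occurring_finite.mem_toFinset.mpr ⟨X, hX₁, hY⟩)
    refine apply_tr_conv _ σ _ (Subst.atoms_map_subset hσ₁L X)
      (fun Y hY => .of_eq (instSubst_map_allowed (hocc Y hY)))
      (fun Y _ a ha => hσE _ ha) _ ?_ ?_
    · intro a ha
      simpa using ha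
    · intro a ha
      simpa using ha
  -- Outside `Dom(σ₁)` the λ-variable keeps all of `L` as parameters, so the other copy of `X` in
  -- `instSubst` is used.
  · rw [trSubst_map_of_notMem hX₁, apply_fvar, instSubst_map (Finset.mem_union_left _ hX),
      Subst.apply_map_of_notMem σ σ₁ hX₁]
    exact .refl _

theorem moreGeneral_of_lam_moreGeneral {L : List (AnyAtom S)} (hL : L.Nodup)
    {E₁ E₂ : FreshEnv S} {σ₁ σ₂ : Subst S} (hE₁L : ∀ p ∈ E₁, p.1 ∈ L)
    (hσ₁L : ∀ a ∈ σ₁.atoms, a ∈ L) (hσ₂L : ∀ a ∈ σ₂.atoms, a ∈ L) (hdom : σ₁.dom ⊆ σ₂.dom)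
    (hE : ∀ p ∈ E₁, (p.2 ∈ σ₂.dom → p.2 ∈ σ₁.dom) ∧
      (p.2 ∈ σ₁.occurring ∨ ∃ t : Term S (.base p.2.1), t.vars = ∅))
    (h : Lam.MoreGeneral (trSubst L E₁ σ₁) (trSubst L E₂ σ₂)) :
    MoreGeneral E₁ σ₁ E₂ σ₂ := by
  classical
  obtain ⟨θ, hθ⟩ := h
  have hΓ : L ⊆ L.reverseAux [] := fun a ha => by simpa using ha
  have hΓ' : L.reverseAux [] ⊆ L := fun a ha => by simpa using ha
  have hθ₁ : ∀ X ∈ σ₁.dom, Conv (θ.apply (tr L E₁ (L.reverseAux []) (σ₁.map X.1 X.2)))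
      (tr L E₂ (L.reverseAux []) (σ₂.map X.1 X.2)) := by
    intro X hX
    have := hθ (.inr X) (varTy L X) (.inl (mem_trSubst_dom.mpr ⟨X, hX, rfl⟩))
    rw [trSubst_map_of_mem hX, trSubst_map_of_mem (hdom hX)] at this
    exact (apply_trLams_conv_iff _ _ _ _ _).mp this
  have hθ₂ : ∀ X ∈ σ₂.dom, X ∉ σ₁.dom →
      Conv (θ.map (.inr X) (varTy L X)) (trLams L E₂ (σ₂.map X.1 X.2) L []) := by
    intro X hX hX₁
    have := hθ (.inr X) (varTy L X) (.inr (mem_trSubst_dom.mpr ⟨X, hX, rfl⟩))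
    rwa [trSubst_map_of_notMem hX₁, trSubst_map_of_mem hX, apply_fvar] at this
  have hallowed : ∀ X : AnyVar S, (∀ a, (a, X) ∉ E₁) → allowed L E₁ X = L := by
    intro X hX
    exact List.filter_eq_self.mpr fun a _ => by simpa using hX a
  let F := σ₂.dom ∪ σ₁.occurring_finite.toFinset ∪ (E₁.map Prod.snd).toFinset
  -- The values of `σ'` are chosen one variable at a time. Where conversion to `θ(X)` is needed, the
  -- atoms must also stay in `L`, because injectivity of the translation will be applied to the
  -- instances.
  have key : ∀ X : AnyVar S, ∃ s : Term S (.base X.1),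
      (X ∈ σ₁.occurring ∨ (X ∈ σ₂.dom ∧ X ∉ σ₁.dom) → s.atoms ⊆ {a | a ∈ L} ∧
        Conv (θ.map (.inr X) (varTy (allowed L E₁ X) X))
          (trLams L E₂ s (allowed L E₁ X) [])) ∧
      (∀ a, (a, X) ∈ E₁ → Fresh E₂ a s) ∧ (X ∉ F → s = .susp [] X.2) := by
    intro X
    by_cases h₁ : X ∈ σ₁.occurring
    · obtain ⟨Y, hY, hX⟩ := h₁
      obtain ⟨s, hs₁, hs₂, hs₃⟩ := exists_term_of_conv θ hL _ (Subst.atoms_map_subset hσ₁L Y) _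
        (Subst.atoms_map_subset hσ₂L Y) _ hΓ hΓ' (hθ₁ Y hY) X hX
      refine ⟨s, fun _ => ⟨hs₁, hs₂⟩, fun a ha => hs₃ a (hE₁L _ ha) ha, fun hF => ?_⟩
      exact (hF (Finset.mem_union_left _ (Finset.mem_union_right _
        (σ₁.occurring_finite.mem_toFinset.mpr ⟨Y, hY, hX⟩)))).elim
    · by_cases h₂ : X ∈ σ₂.dom ∧ X ∉ σ₁.dom
      -- By (i) such a variable is unconstrained, so its two parameter lists coincide and its value
      -- under `σ₂` may be used.
      · have hX : ∀ a, (a, X) ∉ E₁ := fun a ha => h₂.2 ((hE _ ha).1 h₂.1)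
        refine ⟨σ₂.map X.1 X.2, fun _ => ⟨Subst.atoms_map_subset hσ₂L X, ?_⟩,
          fun a ha => (hX a ha).elim, fun hF => ?_⟩
        · rw [hallowed X hX]
          exact hθ₂ X h₂.1 h₂.2
        · exact (hF (Finset.mem_union_left _ (Finset.mem_union_left _ h₂.1))).elim
      · by_cases h₃ : ∃ a, (a, X) ∈ E₁
        · obtain ⟨a, ha⟩ := h₃
          obtain ⟨t, ht⟩ := (hE _ ha).2.resolve_left h₁
          -- `X` occurs nowhere in `σ₁`, so only its constraints matter; a variable-free term with
          -- atoms outside `L` satisfies all of them.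
          obtain ⟨t', ht'₁, ht'₂⟩ := exists_term_atoms_notMem L t ht
          refine ⟨t', fun h => (h.elim h₁ h₂).elim, fun a' ha' => ?_, fun hF => ?_⟩
          · exact Fresh.of_notMem (fun hc => ht'₂ a' hc (hE₁L _ ha')) ht'₁
          · exact (hF (Finset.mem_union_right _ (List.mem_toFinset.mpr
              (List.mem_map.mpr ⟨_, ha, rfl⟩)))).elim
        · exact ⟨.susp [] X.2, fun h => (h.elim h₁ h₂).elim, fun a ha => (h₃ ⟨a, ha⟩).elim,
            fun _ => rfl⟩
  choose s hs₁ hs₂ hs₃ using key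
  refine ⟨⟨F, fun b X => s ⟨b, X⟩, fun b X hX => hs₃ ⟨b, X⟩ hX⟩, fun p hp => hs₂ p.2 p.1 hp,
    fun X hX => ?_⟩
  by_cases hX₁ : X ∈ σ₁.dom
  · have hocc : ∀ Y ∈ (σ₁.map X.1 X.2).vars, Y ∈ σ₁.occurring := fun Y hY => ⟨X, hX₁, hY⟩
    have hc := apply_tr_conv θ ⟨F, fun b X => s ⟨b, X⟩, fun b X hX => hs₃ ⟨b, X⟩ hX⟩
      (σ₁.map X.1 X.2) (Subst.atoms_map_subset hσ₁L X)
      (fun Y hY => (hs₁ Y (.inl (hocc Y hY))).2) (fun Y _ a ha => hs₂ Y a ha) _ hΓ hΓ'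
    -- The instance of `σ₁(X)` under `θ` converts to the translations of both `σ'(σ₁(X))` and
    -- `σ₂(X)`, so these normal forms are equal.
    refine alphaEq_of_tr_eq _ _ _ hΓ ?_ (Subst.atoms_map_subset hσ₂L X)
      (Normal.eq_of_conv (normal_tr _ _ _ _) (normal_tr _ _ _ _) (hc.symm.trans (hθ₁ X hX₁)))
    exact Subst.atoms_apply_subset _ _ (Subst.atoms_map_subset hσ₁L X) fun Y hY =>
      (hs₁ Y (.inl (hocc Y hY))).1
  · have hX₂ := hX.resolve_left hX₁
    obtain ⟨ha, hc⟩ := hs₁ X (.inr ⟨hX₂, hX₁⟩)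
    rw [hallowed X fun a ha => hX₁ ((hE _ ha).1 hX₂)] at hc
    rw [Subst.apply_map_of_notMem _ σ₁ hX₁]
    exact conv_trLams ha (Subst.atoms_map_subset hσ₂L X) (hc.symm.trans (hθ₂ X hX₂ hX₁))

end Nominal

theorem mainTheorem6 (S : Nominal.Signature.{u})
    (L : List (Nominal.AnyAtom S)) (hL : L.Nodup)
    (P : Nominal.Problem S) (E₁ E₂ : Nominal.FreshEnv S) (σ₁ σ₂ : Nominal.Subst S)
    (hPL : ∀ a ∈ P.atoms, a ∈ L)
    (hE₁L : ∀ p ∈ E₁, p.1 ∈ L) (hE₂L : ∀ p ∈ E₂, p.1 ∈ L)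
    (hσ₁L : ∀ a ∈ σ₁.atoms, a ∈ L) (hσ₂L : ∀ a ∈ σ₂.atoms, a ∈ L)
    (h₁ : Nominal.IsUnifier P E₁ σ₁) (h₂ : Nominal.IsUnifier P E₂ σ₂)
    (hP : ∀ X ∈ P.vars, X ∈ σ₁.dom) (hdom : σ₁.dom ⊆ σ₂.dom) :
    (Nominal.MoreGeneral E₁ σ₁ E₂ σ₂ →
      Lam.MoreGeneral (Nominal.trSubst L E₁ σ₁) (Nominal.trSubst L E₂ σ₂)) ∧
    ((∀ p ∈ E₁, (p.2 ∈ σ₂.dom → p.2 ∈ σ₁.dom) ∧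
        (p.2 ∈ σ₁.occurring ∨ ∃ t : Nominal.Term S (.base p.2.1), t.vars = ∅)) →
      Lam.MoreGeneral (Nominal.trSubst L E₁ σ₁) (Nominal.trSubst L E₂ σ₂) →
      Nominal.MoreGeneral E₁ σ₁ E₂ σ₂) :=
  ⟨Nominal.lam_moreGeneral_of_moreGeneral hσ₁L hdom,
    Nominal.moreGeneral_of_lam_moreGeneral hL hE₁L hσ₁L hσ₂L hdom⟩
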